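/- Conventions. All functions below are total functions on $\omega=\mathbb N$. A *computable graph* is a symmetric irreflexive graph with domain $\omega$ whose edge relation is decidable. The distance function $d_H$ of a connected graph $H$ gives the length of a shortest path between two vertices; it is regarded as a function on $\omega$ through a computable pairing function. A function $g(x,s)$ is an *$n$-approximation of $f$ from above* if $g$ is total computable, $\lim_s g(x,s)=f(x)$ for all $x$, $g(x,s+1)\le g(x,s)$ for all $x,s$, and $|\{s: g(x,s)\ne g(x,s+1)\}|\le n$ for all $x$; $f$ is *$n$-approximable from above* if such a $g$ exists. The distance function on $G$ is *intrinsically $n$-approximable from above* if $d_H$ is $n$-approximable from above for every computable graph $H\cong G$. The *countdown function* of $g$ with bound $n$ is $c(x,0)=n$, with $c(x,s+1)=c(x,s)-1$ if $g(x,s)\neq g(x,s+1)$ and $c(x,s+1)=c(x,s)$ otherwise. We write $\alpha\le_{k\text{-btt}}\beta$ if there are a computable function assigning to each $x$ (an explicit list of) a finite set $D_x$ with $|D_x|\le k$ and a total computable $t$ with $\alpha(x)=t(x,\beta\upharpoonright D_x)$ for all $x$. We write $\alpha\le_{\mathrm{bT}}\beta$ if there are a Turing functional $\Phi$ and a computable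 $u$ such that for all $x$, $\Phi^{\beta}(x)=\alpha(x)$ by a computation that asks the oracle only for values $\beta(y)$ with $y<u(x)$. The bT-degree of $\alpha$ is the class of all $\beta$ with $\beta\le_{\mathrm{bT}}\alpha\le_{\mathrm{bT}}\beta$. The *bT-degree spectrum of the distance function on $G$* is the set of bT-degrees of $d_H$, over all computable graphs $H\cong G$. Theorem. For every $n\in\omega$ there is a computable connected graph $G$ such that: 1. the distance function on $G$ is intrinsically $n$-approximable from above; 2. for every function $f$ and every $n$-approximation $g$ of $f$ from above there is a computable graph $H\cong G$ with $$d_H\le_{2\text{-btt}}\lim_s c\le_{1\text{-btt}} d_H,$$ where $c$ is the countdown function of $g$ with bound $n$ (and $\lim_s c(x,s)$ exists for every $x$); 3. the bT-degree spectrum of the distance function on $G$ consists of exactly those bT-degrees that contain a function $n$-approximable from above. -/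

import Mathlib

/-! ### Approximations from above and countdown functions -/

/-- `f` is the pointwise limit of the approximation `g`: `f x = lim_s g x s` (in the discrete
space `ℕ`, so that `g x s` is eventually equal to `f x`). -/
def IsPointwiseLimit (g : ℕ → ℕ → ℕ) (f : ℕ → ℕ) : Prop :=
  ∀ x, ∀ᶠ s in Filter.atTop, g x s = f x

/-- `g` is a computable `n`-approximation of `f` from above: it is total computable, converges
to `f`, is nonincreasing in the stage `s`, and changes its mind at most `n` times at each `x`. -/
structure IsNApproxFromAbove (n : ℕ) (g : ℕ → ℕ → ℕ) (f : ℕ → ℕ) : Prop where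
  computable : Computable₂ g
  limit : IsPointwiseLimit g f
  anti : ∀ x s, g x (s + 1) ≤ g x s
  changes : ∀ x, {s | g x s ≠ g x (s + 1)}.encard ≤ n

/-- `f` is `n`-approximable from above. -/
def NApproximableFromAbove (n : ℕ) (f : ℕ → ℕ) : Prop :=
  ∃ g, IsNApproxFromAbove n g f

/-- The countdown function of the approximation `g` with bound `h`: it starts at `h x` and drops
by one each time `g x` changes. (If `g x` changes at most `h x` times, the subtraction never
truncates.) -/
def countdown (g : ℕ → ℕ → ℕ) (h : ℕ → ℕ) (x : ℕ) : ℕ → ℕ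
  | 0 => h x
  | s + 1 => if g x s ≠ g x (s + 1) then countdown g h x s - 1 else countdown g h x s

/-! ### Reducibilities on total functions -/

/-- `α ≤ β` by a bounded truth-table reduction of norm `k`. The finite set of oracle questions on
input `x` is presented by the explicit list `q x` of its elements, with at most `k` entries;
`t` is the total computable function that receives `x` and the list of oracle values on `q x`. -/
def BTTReducible (k : ℕ) (α β : ℕ → ℕ) : Prop :=
  ∃ (q : ℕ → List ℕ) (t : ℕ → List ℕ → ℕ), Computable q ∧ Computable₂ t ∧
    ∀ x, (q x).length ≤ k ∧ α x = t x ((q x).map β)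

/-- The Turing functionals `F ↦ Φ^F`: the smallest class of operators on partial functions that
contains the initial functions and the oracle `F` itself and is closed, uniformly in `F`,
under pairing, composition, primitive recursion and minimization. A query to the oracle outside
its domain makes the computation diverge. -/
inductive TuringFunctional : ((ℕ →. ℕ) → (ℕ →. ℕ)) → Prop
  | zero : TuringFunctional fun _ _ => Part.some 0
  | succ : TuringFunctional fun _ x => Part.some (x + 1)
  | left : TuringFunctional fun _ x => Part.some x.unpair.1
  | right : TuringFunctional fun _ x => Part.some x.unpair.2
  | oracle : TuringFunctional fun F => F
  | pair {Φ Ψ : (ℕ →. ℕ) → (ℕ →. ℕ)} : TuringFunctional Φ → TuringFunctional Ψ →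
      TuringFunctional fun F x =>
        (Φ F x).bind fun a => (Ψ F x).map fun b => Nat.pair a b
  | comp {Φ Ψ : (ℕ →. ℕ) → (ℕ →. ℕ)} : TuringFunctional Φ → TuringFunctional Ψ →
      TuringFunctional fun F x => (Ψ F x).bind (Φ F)
  | prec {Φ Ψ : (ℕ →. ℕ) → (ℕ →. ℕ)} : TuringFunctional Φ → TuringFunctional Ψ →
      TuringFunctional fun F x =>
        Nat.rec (motive := fun _ => Part ℕ) (Φ F x.unpair.1)
          (fun y r => r.bind fun i => Ψ F (Nat.pair x.unpair.1 (Nat.pair y i))) x.unpair.2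
  | rfind {Φ : (ℕ →. ℕ) → (ℕ →. ℕ)} : TuringFunctional Φ →
      TuringFunctional fun F x =>
        Nat.rfind fun m => (Φ F (Nat.pair x m)).map fun v => decide (v = 0)

/-- The restriction of `β` to arguments below `b`, as a partial function. -/
def restrictBelow (β : ℕ → ℕ) (b : ℕ) : ℕ →. ℕ :=
  fun y => Part.assert (y < b) fun _ => Part.some (β y)

/-- `α` is bounded-Turing reducible to `β`: some Turing functional computes `α x` from `β`
asking only for values `β y` with `y < u x`, where the bound `u` is computable. -/
def BoundedTuringReducible (α β : ℕ → ℕ) : Prop :=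
  ∃ (Φ : (ℕ →. ℕ) → (ℕ →. ℕ)) (u : ℕ → ℕ), TuringFunctional Φ ∧ Computable u ∧
    ∀ x, Φ (restrictBelow β (u x)) x = Part.some (α x)

/-- The bounded-Turing degree of `α`: all functions bounded-Turing equivalent to it. -/
def boundedTuringDegree (α : ℕ → ℕ) : Set (ℕ → ℕ) :=
  {β | BoundedTuringReducible β α ∧ BoundedTuringReducible α β}

/-! ### Computable graphs and their distance functions -/

/-- A (symmetric, irreflexive) graph with domain `ℕ` is computable if its edge relation is. -/
def ComputableGraph (G : SimpleGraph ℕ) : Prop :=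
  ComputablePred fun p : ℕ × ℕ => G.Adj p.1 p.2

/-- `H` is a computable copy of `G`. -/
def IsComputableCopy (G H : SimpleGraph ℕ) : Prop :=
  ComputableGraph H ∧ Nonempty (G ≃g H)

/-- The distance function of `G`, as a function on codes of pairs of vertices. -/
noncomputable def distanceFunction (G : SimpleGraph ℕ) (p : ℕ) : ℕ :=
  G.dist p.unpair.1 p.unpair.2

/-- The distance function on `G` is intrinsically `n`-approximable from above. -/
def IntrinsicallyNApproximableFromAbove (n : ℕ) (G : SimpleGraph ℕ) : Prop :=
  ∀ H, IsComputableCopy G H → NApproximableFromAbove n (distanceFunction H)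

/-- The bounded-Turing degree spectrum of the distance function on `G`: the degrees of the distance
functions of all computable copies of `G`. -/
def distanceSpectrum (G : SimpleGraph ℕ) : Set (Set (ℕ → ℕ)) :=
  {D | ∃ H, IsComputableCopy G H ∧ D = boundedTuringDegree (distanceFunction H)}

/-! ### Turing functionals and bounded-Turing reducibility -/

/-! The graph has diameter at most `n + 2`, and distances 0 and 1 are decidable in any computable
copy. A search for walks therefore revises its estimate only between `n + 2` and 2, hence at most
`n` times. Since the diameter is invariant, this holds in every computable copy
(`nApproximable_distanceFunction`).

To code an approximation, each `x` receives a gadget with two endpoints and a path starting in the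
second one. Whenever the countdown at `x` drops to `c`, a vertex is added that joins the first
endpoint to the path at position `c`, which opens a route of length `c + 2` between the endpoints.
If the final value is `k`, the countdown has dropped to exactly the values `c` with `k ≤ c < n`, so
the gadget depends only on `k`, and its endpoints end up at distance `k + 2` (`dist_endpoints`).
Stages without a drop add isolated vertices. Once every final value is attained infinitely often,
which interleaving with explicit counters ensures, the isomorphism type no longer depends on the
approximation (`nonempty_copyGraph_iso`). Legs joined at their tops make everything connected with
diameter at most `n + 2`, and they offer no route between two feet of different legs shorter than `n
+ 2` (`le_add_dist_spider`).

Permutations of gadgets of equal type are automorphisms. A distance is thus read off a finite table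
from the heights, slots and gadget types of the two vertices and from whether their gadgets coincide
(`exists_table`); only the two types need the oracle. Conversely, one distance reveals one final
value. For the spectrum, `f` and the limit of the countdown are bounded-Turing equivalent because
the approximation and its countdown settle at the same stage
(`IsNApproxFromAbove.mem_boundedTuringDegree`). -/

theorem mem_restrictBelow {β : ℕ → ℕ} {b y z : ℕ} :
    z ∈ restrictBelow β b y ↔ y < b ∧ β y = z := by
  simp [restrictBelow, eq_comm]

/-- A halting computation uses only values the oracle has supplied, so enlarging the oracle
preserves it. This lets query bounds be raised when reductions are composed. -/
theorem TuringFunctional.mono {Φ : (ℕ →. ℕ) → (ℕ →. ℕ)} (hΦ : TuringFunctional Φ)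
    {F F' : ℕ →. ℕ} (h : ∀ x y, y ∈ F x → y ∈ F' x) : ∀ x y, y ∈ Φ F x → y ∈ Φ F' x := by
  induction hΦ with
  | zero => intro x y hy; exact hy
  | succ => intro x y hy; exact hy
  | left => intro x y hy; exact hy
  | right => intro x y hy; exact hy
  | oracle => exact h
  | pair _ _ ih₁ ih₂ =>
    intro x y hy
    simp only [Part.mem_bind_iff, Part.mem_map_iff] at hy ⊢
    obtain ⟨a, ha, b, hb, rfl⟩ := hy
    exact ⟨a, ih₁ _ _ ha, b, ih₂ _ _ hb, rfl⟩
  | comp _ _ ih₁ ih₂ =>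
    intro x y hy
    obtain ⟨a, ha, hy⟩ := Part.mem_bind_iff.1 hy
    exact Part.mem_bind_iff.2 ⟨a, ih₂ _ _ ha, ih₁ _ _ hy⟩
  | prec _ _ ih₁ ih₂ =>
    intro x
    beta_reduce
    generalize x.unpair.2 = k
    induction k with
    | zero => exact ih₁ _
    | succ k ih =>
      intro y hy
      obtain ⟨a, ha, hy⟩ := Part.mem_bind_iff.1 hy
      exact Part.mem_bind_iff.2 ⟨a, ih _ ha, ih₂ _ _ hy⟩
  | rfind _ ih =>
    intro x y hy
    obtain ⟨h₁, h₂⟩ := Nat.mem_rfind.1 hy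
    refine Nat.mem_rfind.2 ⟨?_, fun {m} hm => ?_⟩
    · obtain ⟨a, ha, e⟩ := (Part.mem_map_iff _).1 h₁
      exact (Part.mem_map_iff _).2 ⟨a, ih _ _ ha, e⟩
    · obtain ⟨a, ha, e⟩ := (Part.mem_map_iff _).1 (h₂ hm)
      exact (Part.mem_map_iff _).2 ⟨a, ih _ _ ha, e⟩

theorem TuringFunctional.subst {Φ Ψ : (ℕ →. ℕ) → (ℕ →. ℕ)} (hΦ : TuringFunctional Φ)
    (hΨ : TuringFunctional Ψ) : TuringFunctional fun F => Φ (Ψ F) := by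
  induction hΦ with
  | zero => exact .zero
  | succ => exact .succ
  | left => exact .left
  | right => exact .right
  | oracle => exact hΨ
  | pair _ _ ih₁ ih₂ => exact .pair ih₁ ih₂
  | comp _ _ ih₁ ih₂ => exact .comp ih₁ ih₂
  | prec _ _ ih₁ ih₂ => exact .prec ih₁ ih₂
  | rfind _ ih => exact .rfind ih

theorem TuringFunctional.of_partrec {ψ : ℕ →. ℕ} (hψ : Nat.Partrec ψ) :
    TuringFunctional fun _ => ψ := by
  induction hψ with
  | zero => exact .zero
  | succ => exact .succ
  | left => exact .left
  | right => exact .right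
  | pair _ _ ih₁ ih₂ =>
    convert TuringFunctional.pair ih₁ ih₂ using 3
    simp [Seq.seq]
  | comp _ _ ih₁ ih₂ => exact .comp ih₁ ih₂
  | prec _ _ ih₁ ih₂ => exact .prec ih₁ ih₂
  | rfind _ ih => exact .rfind ih

/-- The inner reduction in a composition runs on all `y` below the outer bound and needs one query
bound for all of them: a running maximum. -/
theorem Computable.max_below {w : ℕ → ℕ} (hw : Computable w) :
    ∃ W : ℕ → ℕ, Computable W ∧ ∀ b y, y < b → w y ≤ W b := by
  refine ⟨fun b => Nat.rec 0 (fun y acc => max acc (w y)) b, ?_, ?_⟩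
  · exact Computable.nat_rec Computable.id (Computable.const 0)
      ((Primrec.nat_max.to_comp.comp (Computable.snd.comp Computable.snd)
        (hw.comp (Computable.fst.comp Computable.snd))).to₂)
  · intro b
    induction b with
    | zero => intro y hy; omega
    | succ b ih =>
      intro y hy
      rcases Nat.lt_succ_iff_lt_or_eq.1 hy with h | rfl
      · exact (ih y h).trans (le_max_left _ _)
      · exact le_max_right _ _

theorem BoundedTuringReducible.trans {α β γ : ℕ → ℕ} (h₁ : BoundedTuringReducible α β)
    (h₂ : BoundedTuringReducible β γ) : BoundedTuringReducible α γ := by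
  obtain ⟨Φ, u, hΦ, hu, h₁⟩ := h₁
  obtain ⟨Ψ, w, hΨ, hw, h₂⟩ := h₂
  obtain ⟨W, hW, hwW⟩ := hw.max_below
  refine ⟨_, fun x => W (u x), hΦ.subst hΨ, hW.comp hu, fun x => ?_⟩
  refine Part.eq_some_iff.2 (hΦ.mono (F := restrictBelow β (u x)) ?_ _ _
    (Part.eq_some_iff.1 (h₁ x)))
  intro y z hz
  obtain ⟨hy, rfl⟩ := mem_restrictBelow.1 hz
  refine hΨ.mono (F := restrictBelow γ (w y)) ?_ _ _ (Part.eq_some_iff.1 (h₂ y))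
  intro y' z hz
  rw [mem_restrictBelow] at hz ⊢
  exact ⟨hz.1.trans_le (hwW _ _ hy), hz.2⟩

/-- A partial computable evaluation of two oracle values at computable places. -/
theorem BoundedTuringReducible.of_partrec₂ {α β q₁ q₂ : ℕ → ℕ} {ψ : ℕ →. ℕ}
    (hψ : Nat.Partrec ψ) (h₁ : Computable q₁) (h₂ : Computable q₂)
    (h : ∀ x, α x ∈ ψ (Nat.pair x (Nat.pair (β (q₁ x)) (β (q₂ x))))) :
    BoundedTuringReducible α β := by
  have hid : TuringFunctional fun _ x => Part.some x :=
    .of_partrec (Partrec.nat_iff.1 (Computable.id.partrec))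
  have hq : ∀ {q : ℕ → ℕ}, Computable q →
      TuringFunctional fun F x => (Part.some (q x)).bind F := fun {q} hq =>
    TuringFunctional.oracle.comp (.of_partrec (Partrec.nat_iff.1 hq.partrec))
  refine ⟨_, fun x => max (q₁ x) (q₂ x) + 1,
    (TuringFunctional.of_partrec hψ).comp (hid.pair ((hq h₁).pair (hq h₂))),
    Computable.succ.comp (Primrec.nat_max.to_comp.comp h₁ h₂), fun x => ?_⟩
  have e₁ : β (q₁ x) ∈ restrictBelow β (max (q₁ x) (q₂ x) + 1) (q₁ x) :=
    mem_restrictBelow.2 ⟨by omega, rfl⟩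
  have e₂ : β (q₂ x) ∈ restrictBelow β (max (q₁ x) (q₂ x) + 1) (q₂ x) :=
    mem_restrictBelow.2 ⟨by omega, rfl⟩
  refine Part.eq_some_iff.2
    (Part.mem_bind_iff.2 ⟨Nat.pair x (Nat.pair (β (q₁ x)) (β (q₂ x))), ?_, h x⟩)
  simp only [Part.mem_bind_iff, Part.mem_map_iff]
  exact ⟨x, Part.mem_some _, _, ⟨_, Part.mem_bind (Part.mem_some _) e₁, _,
    Part.mem_bind (Part.mem_some _) e₂, rfl⟩, rfl⟩

theorem BoundedTuringReducible.of_partrec {α β q : ℕ → ℕ} {ψ : ℕ → ℕ →. ℕ}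
    (hψ : Partrec₂ ψ) (hq : Computable q) (h : ∀ x, α x ∈ ψ x (β (q x))) :
    BoundedTuringReducible α β := by
  have hc : Computable fun z : ℕ => (z.unpair.1, z.unpair.2.unpair.1) :=
    (Computable.fst.comp Computable.unpair).pair (Computable.fst.comp
      (Computable.unpair.comp (Computable.snd.comp Computable.unpair)))
  exact .of_partrec₂ (Partrec.nat_iff.1 (Partrec.comp hψ hc)) hq hq (by simpa using h)

theorem BoundedTuringReducible.refl (α : ℕ → ℕ) : BoundedTuringReducible α α :=
  ⟨_, fun x => x + 1, .oracle, Computable.succ, fun x =>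
    Part.eq_some_iff.2 (mem_restrictBelow.2 ⟨x.lt_succ_self, rfl⟩)⟩

theorem BTTReducible.mono {k l : ℕ} {α β : ℕ → ℕ} (h : BTTReducible k α β) (hkl : k ≤ l) :
    BTTReducible l α β := by
  obtain ⟨q, t, hq, ht, h⟩ := h
  exact ⟨q, t, hq, ht, fun x => ⟨(h x).1.trans hkl, (h x).2⟩⟩

theorem BTTReducible.boundedTuring {α β : ℕ → ℕ} (h : BTTReducible 2 α β) :
    BoundedTuringReducible α β := by
  obtain ⟨q, t, hq, ht, h⟩ := h
  have hd : Computable (List.headI : List ℕ → ℕ) := Primrec.list_headI.to_comp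
  have hl : Computable (List.tail : List ℕ → List ℕ) := Primrec.list_tail.to_comp
  have h₁ : Computable fun z : ℕ => z.unpair.1 := Computable.fst.comp Computable.unpair
  have h₂ : Computable fun z : ℕ => z.unpair.2 := Computable.snd.comp Computable.unpair
  -- Two questions are always asked, the default 0 standing in for missing ones; the answers are
  -- then cut to the true number of questions before `t` sees them.
  have htake : Computable₂ fun (k : ℕ) (v : ℕ × ℕ) => [v.1, v.2].take k := by
    have : Primrec₂ fun (k : ℕ) (v : ℕ × ℕ) =>
        if k = 0 then [] else if k = 1 then [v.1] else [v.1, v.2] := by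
      have a := Primrec.fst.comp (Primrec.snd (α := ℕ) (β := ℕ × ℕ))
      have b := Primrec.snd.comp (Primrec.snd (α := ℕ) (β := ℕ × ℕ))
      refine Primrec.ite (Primrec.eq.comp Primrec.fst (Primrec.const 0)) (Primrec.const []) ?_
      refine Primrec.ite (Primrec.eq.comp Primrec.fst (Primrec.const 1)) ?_ ?_
      · exact Primrec.list_cons.comp a (Primrec.const [])
      · exact Primrec.list_cons.comp a (Primrec.list_cons.comp b (Primrec.const []))
    refine this.to_comp.of_eq fun p => ?_
    obtain ⟨_ | _ | k, v⟩ := p <;> simp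
  have hψ : Computable fun z : ℕ => t z.unpair.1
      ([z.unpair.2.unpair.1, z.unpair.2.unpair.2].take (q z.unpair.1).length) :=
    ht.comp h₁ (htake.comp (Computable.list_length.comp (hq.comp h₁))
      ((h₁.comp h₂).pair (h₂.comp h₂)))
  refine .of_partrec₂ (Partrec.nat_iff.1 hψ.partrec) (hd.comp hq) (hd.comp (hl.comp hq))
    fun x => ?_
  obtain ⟨hlen, hx⟩ := h x
  simp only [Nat.unpair_pair, PFun.coe_val, Part.mem_some_iff]
  rw [hx]
  congr 1
  match q x, hlen with
  | [], _ => rfl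
  | [_], _ => rfl
  | [_, _], _ => rfl

theorem boundedTuringDegree_eq {α β : ℕ → ℕ} (h : β ∈ boundedTuringDegree α) :
    boundedTuringDegree β = boundedTuringDegree α := by
  ext γ
  exact ⟨fun hγ => ⟨hγ.1.trans h.1, h.2.trans hγ.2⟩,
    fun hγ => ⟨hγ.1.trans h.2, h.1.trans hγ.2⟩⟩

theorem self_mem_boundedTuringDegree (α : ℕ → ℕ) : α ∈ boundedTuringDegree α :=
  ⟨.refl α, .refl α⟩

/-! ### Mind changes and countdown functions -/

/-- Every change of a nonincreasing sequence costs at least one. -/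
theorem card_changes_add_le {a : ℕ → ℕ} (ha : ∀ s, a (s + 1) ≤ a s) (s : ℕ) :
    ((Finset.range s).filter fun t => a t ≠ a (t + 1)).card + a s ≤ a 0 := by
  induction s with
  | zero => simp
  | succ s ih =>
    have h := ha s
    rw [Finset.range_add_one, Finset.filter_insert]
    split_ifs with hs
    · rw [Finset.card_insert_of_notMem (by simp)]
      omega
    · omega

theorem encard_changes_le {a : ℕ → ℕ} {n : ℕ} (ha : ∀ s, a (s + 1) ≤ a s)
    (hn : ∀ s, a 0 ≤ a s + n) : {s | a s ≠ a (s + 1)}.encard ≤ n := by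
  by_contra! h
  obtain ⟨T, hT, hc⟩ := Set.exists_subset_encard_eq (Order.add_one_le_of_lt h)
  have hfin : T.Finite := Set.finite_of_encard_eq_coe (k := n + 1) (by exact_mod_cast hc)
  obtain ⟨b, hb⟩ := hfin.bddAbove
  have hsub : hfin.toFinset ⊆ (Finset.range (b + 1)).filter fun t => a t ≠ a (t + 1) := by
    intro t ht
    rw [Set.Finite.mem_toFinset] at ht
    simpa [Nat.lt_succ_iff] using ⟨hb ht, hT ht⟩
  have h₁ := Finset.card_le_card hsub
  have h₂ := card_changes_add_le ha (b + 1)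
  have h₃ := hn (b + 1)
  rw [hfin.encard_eq_coe_toFinset_card] at hc
  have h₄ : hfin.toFinset.card = n + 1 := by exact_mod_cast hc
  omega

theorem card_changes_le_of_encard_le {a : ℕ → ℕ} {n : ℕ}
    (h : {s | a s ≠ a (s + 1)}.encard ≤ n) (s : ℕ) :
    ((Finset.range s).filter fun t => a t ≠ a (t + 1)).card ≤ n := by
  have : ((((Finset.range s).filter fun t => a t ≠ a (t + 1) : Finset ℕ) : Set ℕ)).encard ≤ n :=
    (Set.encard_le_encard (by intro t ht; simpa using (Finset.mem_filter.1 ht).2)).trans h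
  rw [Set.encard_coe_eq_coe_finsetCard] at this
  exact_mod_cast this

/-- A sequence of natural numbers that starts at `n` and goes down in steps of one. -/
structure IsCounter (n : ℕ) (a : ℕ → ℕ) : Prop where
  zero : a 0 = n
  step : ∀ s, a (s + 1) = a s ∨ a (s + 1) + 1 = a s

namespace IsCounter

variable {n : ℕ} {a : ℕ → ℕ}

theorem anti (h : IsCounter n a) : Antitone a :=
  antitone_nat_of_succ_le fun s => by have := h.step s; omega

theorem le (h : IsCounter n a) (s : ℕ) : a s ≤ n := h.zero ▸ h.anti s.zero_le

theorem exists_limit (h : IsCounter n a) :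
    ∃ k, (∀ᶠ s in Filter.atTop, a s = k) ∧ ∀ s, k ≤ a s := by
  classical
  have hex : ∃ k s, a s = k := ⟨_, 0, rfl⟩
  obtain ⟨s₀, hs₀⟩ := Nat.find_spec hex
  have hle : ∀ s, Nat.find hex ≤ a s := fun s => Nat.find_min' hex ⟨s, rfl⟩
  refine ⟨Nat.find hex, Filter.eventually_atTop.2 ⟨s₀, fun s hs => ?_⟩, hle⟩
  have := h.anti hs
  have := hle s
  omega

/-- The final value of a counter. -/
noncomputable def limit (h : IsCounter n a) : ℕ := h.exists_limit.choose

theorem eventually_eq_limit (h : IsCounter n a) : ∀ᶠ s in Filter.atTop, a s = h.limit :=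
  h.exists_limit.choose_spec.1

theorem limit_le (h : IsCounter n a) (s : ℕ) : h.limit ≤ a s := h.exists_limit.choose_spec.2 s

theorem limit_le_start (h : IsCounter n a) : h.limit ≤ n := (h.limit_le 0).trans (h.le 0)

theorem limit_eq (h : IsCounter n a) {k : ℕ} (hk : ∀ᶠ s in Filter.atTop, a s = k) :
    h.limit = k := by
  obtain ⟨s, h₁, h₂⟩ := (h.eventually_eq_limit.and hk).exists
  omega

/-- After a drop the counter stays at or below the new value, so no value is entered twice. With
`exists_drop`, the drops correspond exactly to the values from the limit up to `n - 1`. -/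
theorem drop_unique (h : IsCounter n a) {s t : ℕ} (hs : a s ≠ a (s + 1)) (ht : a t ≠ a (t + 1))
    (hst : a (s + 1) = a (t + 1)) : s = t := by
  have h₁ := h.step s
  have h₂ := h.step t
  rcases lt_trichotomy s t with h' | h' | h'
  · have := h.anti (Nat.succ_le_of_lt h')
    simp only [Nat.succ_eq_add_one] at this
    omega
  · exact h'
  · have := h.anti (Nat.succ_le_of_lt h')
    simp only [Nat.succ_eq_add_one] at this
    omega

theorem exists_drop (h : IsCounter n a) {c : ℕ} (hc : h.limit ≤ c) (hn : c < n) :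
    ∃ s, a s ≠ a (s + 1) ∧ a (s + 1) = c := by
  classical
  have hex : ∃ s, a s ≤ c := by
    obtain ⟨s, hs⟩ := h.eventually_eq_limit.exists
    exact ⟨s, hs ▸ hc⟩
  have hspec := Nat.find_spec hex
  rcases hs : Nat.find hex with _ | s
  · rw [hs, h.zero] at hspec
    omega
  · have := Nat.find_min hex (m := s) (by omega)
    rw [hs] at hspec
    have := h.step s
    exact ⟨s, by omega, by omega⟩

end IsCounter

section Countdown

variable {n : ℕ} {g : ℕ → ℕ → ℕ} {f : ℕ → ℕ}

theorem countdown_eq (n : ℕ) (g : ℕ → ℕ → ℕ) (x s : ℕ) :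
    countdown g (fun _ => n) x s =
      n - ((Finset.range s).filter fun t => g x t ≠ g x (t + 1)).card := by
  induction s with
  | zero => simp [countdown]
  | succ s ih =>
    rw [countdown, Finset.range_add_one, Finset.filter_insert, ih]
    split_ifs
    · rw [Finset.card_insert_of_notMem (by simp)]
      omega
    · rfl

theorem IsNApproxFromAbove.countdown_of_ne (h : IsNApproxFromAbove n g f) {x s : ℕ}
    (hs : g x s ≠ g x (s + 1)) :
    countdown g (fun _ => n) x (s + 1) + 1 = countdown g (fun _ => n) x s := by
  have h₁ := card_changes_le_of_encard_le (h.changes x) (s + 1)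
  rw [countdown_eq, countdown_eq]
  rw [Finset.range_add_one, Finset.filter_insert, if_pos hs,
    Finset.card_insert_of_notMem (by simp)] at h₁ ⊢
  omega

theorem countdown_of_eq {h : ℕ → ℕ} {x s : ℕ} (hs : g x s = g x (s + 1)) :
    countdown g h x (s + 1) = countdown g h x s := by
  rw [countdown, if_neg (by simpa using hs)]

theorem IsNApproxFromAbove.isCounter (h : IsNApproxFromAbove n g f) (x : ℕ) :
    IsCounter n (countdown g (fun _ => n) x) where
  zero := rfl
  step s := by
    by_cases hs : g x s = g x (s + 1)
    · exact .inl (countdown_of_eq hs)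
    · exact .inr (h.countdown_of_ne hs)

theorem IsNApproxFromAbove.eq_of_countdown_eq_limit (h : IsNApproxFromAbove n g f) {x s : ℕ}
    (hs : countdown g (fun _ => n) x s = (h.isCounter x).limit) : g x s = f x := by
  -- A later change would push the countdown below its limit.
  have key : ∀ t, s ≤ t → g x t = g x s := by
    intro t ht
    induction t, ht using Nat.le_induction with
    | base => rfl
    | succ t ht ih =>
      by_contra hne
      have h₁ := h.countdown_of_ne (x := x) (s := t) (by rw [ih]; exact fun h => hne h.symm)
      have h₂ := (h.isCounter x).anti ht
      have h₃ := (h.isCounter x).limit_le (t + 1)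
      omega
  obtain ⟨t, ht, hst⟩ := ((h.limit x).and (Filter.eventually_ge_atTop s)).exists
  rw [← ht, key t hst]

/-- Monotonicity is essential: an approximation that has reached its limit cannot leave it and
return, so the countdown has stopped as well. -/
theorem IsNApproxFromAbove.countdown_eq_limit_of_eq (h : IsNApproxFromAbove n g f) {x s : ℕ}
    (hs : g x s = f x) : countdown g (fun _ => n) x s = (h.isCounter x).limit := by
  have hanti : Antitone (g x) := antitone_nat_of_succ_le (h.anti x)
  have hle : ∀ t, f x ≤ g x t := by
    intro t
    obtain ⟨t', h₁, h₂⟩ := ((h.limit x).and (Filter.eventually_ge_atTop t)).exists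
    exact h₁ ▸ hanti h₂
  have hg : ∀ t, s ≤ t → g x t = f x := fun t ht => le_antisymm (hs ▸ hanti ht) (hle t)
  have key : ∀ t, s ≤ t →
      countdown g (fun _ => n) x t = countdown g (fun _ => n) x s := by
    intro t ht
    induction t, ht using Nat.le_induction with
    | base => rfl
    | succ t ht ih =>
      rw [countdown_of_eq (by rw [hg t ht, hg (t + 1) (by omega)]), ih]
  exact ((h.isCounter x).limit_eq
    (Filter.eventually_atTop.2 ⟨s, fun t ht => key t ht⟩)).symm

theorem Computable₂.countdown (hg : Computable₂ g) (n : ℕ) :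
    Computable₂ (countdown g fun _ => n) := by
  have hx : Computable fun p : (ℕ × ℕ) × ℕ × ℕ => p.1.1 := Computable.fst.comp Computable.fst
  have hs : Computable fun p : (ℕ × ℕ) × ℕ × ℕ => p.2.1 := Computable.fst.comp Computable.snd
  have hr : Computable fun p : (ℕ × ℕ) × ℕ × ℕ => p.2.2 := Computable.snd.comp Computable.snd
  have hstep : Computable₂ fun (p : ℕ × ℕ) (q : ℕ × ℕ) =>
      bif g p.1 q.1 == g p.1 (q.1 + 1) then q.2 else q.2 - 1 :=
    Computable.cond (Primrec.beq.to_comp.comp (hg.comp hx hs)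
      (hg.comp hx (Computable.succ.comp hs))) hr (Computable.pred.comp hr)
  refine (Computable.nat_rec Computable.snd (Computable.const n) hstep).of_eq fun p => ?_
  obtain ⟨x, s⟩ := p
  induction s with
  | zero => rfl
  | succ s ih =>
    simp only [_root_.countdown] at ih ⊢
    rw [ih]
    by_cases h : g x s = g x (s + 1)
    · simp [h]
    · simp [h, beq_eq_false_iff_ne.2 h]

theorem search_mem {P : ℕ → ℕ → ℕ → Prop} [∀ x v s, Decidable (P x v s)] {r : ℕ → ℕ → ℕ}
    {x v z : ℕ} (hex : ∃ s, P x v s) (h : ∀ s, P x v s → r x s = z) :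
    z ∈ (Nat.rfind fun s => Part.some (decide (P x v s))).map (r x) := by
  obtain ⟨s₀, hs₀⟩ := hex
  obtain ⟨s, hs, -⟩ := Nat.rfind_min' (p := fun s => decide (P x v s)) (m := s₀) (by simpa)
  have := Nat.rfind_spec hs
  exact (Part.mem_map_iff _).2 ⟨s, hs, h s (by simpa using this)⟩

/-- Search for the first stage at which `p` takes the oracle value and return the value of `r`
there. -/
theorem BoundedTuringReducible.of_search {p r : ℕ → ℕ → ℕ} (hp : Computable₂ p)
    (hr : Computable₂ r) {α β : ℕ → ℕ} (hex : ∀ x, ∃ s, p x s = β x)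
    (h : ∀ x s, p x s = β x → r x s = α x) : BoundedTuringReducible α β := by
  have hx : Computable fun p : (ℕ × ℕ) × ℕ => p.1.1 := Computable.fst.comp Computable.fst
  have hv : Computable fun p : (ℕ × ℕ) × ℕ => p.1.2 := Computable.snd.comp Computable.fst
  have hb : Computable₂ fun (q : ℕ × ℕ) (s : ℕ) => decide (p q.1 s = q.2) :=
    (Primrec.beq.to_comp.comp (hp.comp hx Computable.snd) hv).of_eq fun q => by
      rw [Bool.beq_eq_decide_eq]
  have hψ : Partrec₂ fun (x v : ℕ) =>
      (Nat.rfind fun s => Part.some (decide (p x s = v))).map (r x) :=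
    (Partrec.rfind hb.partrec₂).map (hr.comp hx Computable.snd)
  exact .of_partrec hψ Computable.id fun x =>
    search_mem (P := fun x v s => p x s = v) (hex x) (h x)

theorem IsNApproxFromAbove.mem_boundedTuringDegree (h : IsNApproxFromAbove n g f) {c : ℕ → ℕ}
    (hc : IsPointwiseLimit (countdown g fun _ => n) c) : f ∈ boundedTuringDegree c := by
  have hlim : ∀ x, (h.isCounter x).limit = c x := fun x => (h.isCounter x).limit_eq (hc x)
  have hcd := h.computable.countdown n
  constructor
  · exact .of_search hcd h.computable (fun x => (hc x).exists)
      fun x s hs => h.eq_of_countdown_eq_limit (hs.trans (hlim x).symm)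
  · exact .of_search h.computable hcd (fun x => (h.limit x).exists)
      fun x s hs => (h.countdown_eq_limit_of_eq hs).trans (hlim x)

end Countdown

/-! ### The distance function of a computable graph of bounded diameter -/

theorem Computable.any_range {α : Type*} [Primcodable α] {p : α → ℕ → Bool}
    (hp : Computable₂ p) : Computable₂ fun (a : α) (s : ℕ) => (List.range s).any (p a) := by
  have hstep : Computable₂ fun (q : α × ℕ) (r : ℕ × Bool) => r.2 || p q.1 r.1 :=
    Primrec.or.to_comp.comp (Computable.snd.comp Computable.snd)
      (hp.comp (Computable.fst.comp Computable.fst) (Computable.fst.comp Computable.snd))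
  refine (Computable.nat_rec Computable.snd (Computable.const false) hstep).of_eq fun q => ?_
  obtain ⟨a, s⟩ := q
  induction s with
  | zero => rfl
  | succ s ih =>
    simp only at ih ⊢
    rw [ih, List.range_succ]
    simp

/-- `v` is reached from `u` by a walk of length at most `l + 1` whose intermediate vertices are
below `s`. -/
def reachWithin (A : ℕ → ℕ → Bool) (s : ℕ) : ℕ → ℕ → ℕ → Bool
  | 0, u, v => u == v || A u v
  | l + 1, u, v =>
    reachWithin A s l u v || (List.range s).any fun w => reachWithin A s l u w && A w v

theorem computable_reachWithin {A : ℕ → ℕ → Bool} (hA : Computable₂ A) (l : ℕ) :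
    Computable fun q : (ℕ × ℕ) × ℕ => reachWithin A q.2 l q.1.1 q.1.2 := by
  induction l with
  | zero =>
    have hu : Computable fun q : (ℕ × ℕ) × ℕ => q.1.1 := Computable.fst.comp Computable.fst
    have hv : Computable fun q : (ℕ × ℕ) × ℕ => q.1.2 := Computable.snd.comp Computable.fst
    exact Primrec.or.to_comp.comp (Primrec.beq.to_comp.comp hu hv) (hA.comp hu hv)
  | succ l ih =>
    have hs : Computable fun r : ((ℕ × ℕ) × ℕ) × ℕ => r.1.2 := Computable.snd.comp Computable.fst
    have hu : Computable fun r : ((ℕ × ℕ) × ℕ) × ℕ => r.1.1.1 :=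
      Computable.fst.comp (Computable.fst.comp Computable.fst)
    have hv : Computable fun r : ((ℕ × ℕ) × ℕ) × ℕ => r.1.1.2 :=
      Computable.snd.comp (Computable.fst.comp Computable.fst)
    have hw : Computable fun r : ((ℕ × ℕ) × ℕ) × ℕ => r.2 := Computable.snd
    have hp : Computable₂ fun (q : (ℕ × ℕ) × ℕ) (w : ℕ) =>
        reachWithin A q.2 l q.1.1 w && A w q.1.2 :=
      Primrec.and.to_comp.comp (ih.comp ((hu.pair hw).pair hs)) (hA.comp hw hv)
    exact Primrec.or.to_comp.comp ih
      ((Computable.any_range hp).comp Computable.id Computable.snd)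

theorem reachWithin_mono {A : ℕ → ℕ → Bool} {s t : ℕ} (hst : s ≤ t) (l u v : ℕ)
    (h : reachWithin A s l u v = true) : reachWithin A t l u v = true := by
  induction l generalizing v with
  | zero => exact h
  | succ l ih =>
    simp only [reachWithin, Bool.or_eq_true, List.any_eq_true, List.mem_range,
      Bool.and_eq_true] at h ⊢
    rcases h with h | ⟨w, hw, h₁, h₂⟩
    · exact .inl (ih v h)
    · exact .inr ⟨w, hw.trans_le hst, ih w h₁, h₂⟩

/-! ### Approximating distances by searching for walks -/

section

variable {H : SimpleGraph ℕ} {A : ℕ → ℕ → Bool}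

theorem dist_le_of_reachWithin (hA : ∀ u v, A u v = true ↔ H.Adj u v) (hH : H.Connected)
    {s l u v : ℕ} (h : reachWithin A s l u v = true) : H.dist u v ≤ l + 1 := by
  induction l generalizing v with
  | zero =>
    simp only [reachWithin, Bool.or_eq_true, beq_iff_eq, hA] at h
    rcases h with rfl | h
    · simp
    · simp [SimpleGraph.dist_eq_one_iff_adj.2 h]
  | succ l ih =>
    simp only [reachWithin, Bool.or_eq_true, List.any_eq_true, List.mem_range,
      Bool.and_eq_true, hA] at h
    rcases h with h | ⟨w, hw, h₁, h₂⟩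
    · exact (ih h).trans (by omega)
    · have h₃ := ih h₁
      have h₄ := hH.dist_triangle (u := u) (v := w) (w := v)
      have h₅ := SimpleGraph.dist_eq_one_iff_adj.2 h₂
      omega

theorem exists_reachWithin (hA : ∀ u v, A u v = true ↔ H.Adj u v) (hH : H.Connected)
    {l u v : ℕ} (h : H.dist u v ≤ l + 1) : ∃ s, reachWithin A s l u v = true := by
  induction l generalizing v with
  | zero =>
    refine ⟨0, ?_⟩
    simp only [reachWithin, Bool.or_eq_true, beq_iff_eq, hA]
    rcases Nat.le_one_iff_eq_zero_or_eq_one.1 h with h | h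
    · exact .inl (hH.dist_eq_zero_iff.1 h)
    · exact .inr (SimpleGraph.dist_eq_one_iff_adj.1 h)
  | succ l ih =>
    by_cases h' : H.dist u v ≤ l + 1
    · obtain ⟨s, hs⟩ := ih h'
      exact ⟨s, by simp [reachWithin, hs]⟩
    -- The walk is taken backwards, so that its first edge is the last step into `v`.
    · obtain ⟨p, hp⟩ := hH.exists_walk_length_eq_dist v u
      rw [SimpleGraph.dist_comm] at hp
      cases p with
      | nil => simp at h'
      | @cons _ w _ hvw q =>
        have hq : H.dist u w ≤ l + 1 := by
          rw [SimpleGraph.dist_comm]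
          have := SimpleGraph.dist_le q
          simp only [SimpleGraph.Walk.length_cons] at hp
          omega
        obtain ⟨s, hs⟩ := ih hq
        refine ⟨max s (w + 1), ?_⟩
        simp only [reachWithin, Bool.or_eq_true, List.any_eq_true, List.mem_range,
          Bool.and_eq_true, hA]
        exact .inr ⟨w, by omega, reachWithin_mono (le_max_left _ _) _ _ _ hs, hvw.symm⟩

theorem eventually_reachWithin (hA : ∀ u v, A u v = true ↔ H.Adj u v) (hH : H.Connected)
    (l u v : ℕ) :
    ∀ᶠ s in Filter.atTop, reachWithin A s l u v = decide (H.dist u v ≤ l + 1) := by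
  by_cases h : H.dist u v ≤ l + 1
  · obtain ⟨s₀, hs₀⟩ := exists_reachWithin hA hH h
    filter_upwards [Filter.eventually_ge_atTop s₀] with s hs
    simp [h, reachWithin_mono hs _ _ _ hs₀]
  · refine Filter.Eventually.of_forall fun s => ?_
    simp only [h, decide_false]
    by_contra hne
    exact h (dist_le_of_reachWithin hA hH (by simpa using hne))

/-- The approximation of the distance that at stage `s` knows the walks of length at most `n + 1`
with intermediate vertices below `s`. -/
def distApprox (A : ℕ → ℕ → Bool) (n : ℕ) (p s : ℕ) : ℕ :=
  (bif p.unpair.1 == p.unpair.2 then 0 else 1) +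
    ∑ l ∈ Finset.range (n + 1), bif reachWithin A s l p.unpair.1 p.unpair.2 then 0 else 1

theorem computable₂_distApprox (hA : Computable₂ A) (n : ℕ) : Computable₂ (distApprox A n) := by
  have h₁ : Computable fun z : ℕ × ℕ => z.1.unpair.1 :=
    Computable.fst.comp (Computable.unpair.comp Computable.fst)
  have h₂ : Computable fun z : ℕ × ℕ => z.1.unpair.2 :=
    Computable.snd.comp (Computable.unpair.comp Computable.fst)
  refine Primrec.nat_add.to_comp.comp (Computable.cond (Primrec.beq.to_comp.comp h₁ h₂)
    (Computable.const 0) (Computable.const 1)) ?_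
  induction n + 1 with
  | zero => exact Computable.const 0
  | succ k ih =>
    simp only [Finset.sum_range_succ]
    exact Primrec.nat_add.to_comp.comp ih (Computable.cond
      ((computable_reachWithin hA k).comp ((h₁.pair h₂).pair Computable.snd))
      (Computable.const 0) (Computable.const 1))

/-- The distance is a sum of indicators of the events that it exceeds 0, 1, 2, and so on; this
evaluates the part beyond the first. -/
theorem sum_range_gt (d n : ℕ) :
    (∑ l ∈ Finset.range n, bif decide (d ≤ l + 1) then 0 else 1) = min n (d - 1) := by
  induction n with
  | zero => simp
  | succ n ih =>
    rw [Finset.sum_range_succ, ih]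
    by_cases h : d ≤ n + 1 <;> simp [h] <;> omega

theorem distApprox_succ_le (A : ℕ → ℕ → Bool) (n p s : ℕ) :
    distApprox A n p (s + 1) ≤ distApprox A n p s := by
  refine Nat.add_le_add_left (Finset.sum_le_sum fun l _ => ?_) _
  cases h : reachWithin A s l p.unpair.1 p.unpair.2
  · cases reachWithin A (s + 1) l p.unpair.1 p.unpair.2 <;> simp
  · simp [reachWithin_mono s.le_succ _ _ _ h]

/-- Of the `n + 1` summands, the one for `l = 0` does not depend on the stage, since equality and
adjacency are decided at once. Only `n` of them can drop. -/
theorem distApprox_zero_le (A : ℕ → ℕ → Bool) (n p s : ℕ) :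
    distApprox A n p 0 ≤ distApprox A n p s + n := by
  have hsum : (∑ l ∈ Finset.range n,
      bif reachWithin A 0 (l + 1) p.unpair.1 p.unpair.2 then 0 else 1) ≤ n := by
    refine (Finset.sum_le_card_nsmul _ _ 1 fun l _ => ?_).trans (by simp)
    cases reachWithin A 0 (l + 1) p.unpair.1 p.unpair.2 <;> simp
  simp only [distApprox, Finset.sum_range_succ']
  simp only [reachWithin] at hsum ⊢
  omega

theorem nApproximable_distanceFunction {n : ℕ} (hG : ComputableGraph H) (hH : H.Connected)
    (hd : ∀ u v, H.dist u v ≤ n + 2) : NApproximableFromAbove n (distanceFunction H) := by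
  obtain ⟨A, hc, hA⟩ : ∃ A : ℕ → ℕ → Bool, Computable₂ A ∧ ∀ u v, A u v = true ↔ H.Adj u v := by
    obtain ⟨_, hc⟩ := hG
    exact ⟨fun u v => decide ((fun p : ℕ × ℕ => H.Adj p.1 p.2) (u, v)), hc, by simp⟩
  refine ⟨distApprox A n, computable₂_distApprox hc n, fun p => ?_, distApprox_succ_le A n,
    fun p => encard_changes_le (distApprox_succ_le A n p) (distApprox_zero_le A n p)⟩
  have hev : ∀ᶠ s in Filter.atTop, ∀ l ∈ Finset.range (n + 1),
      reachWithin A s l p.unpair.1 p.unpair.2 =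
        decide (H.dist p.unpair.1 p.unpair.2 ≤ l + 1) :=
    (Filter.eventually_all_finset _).2 fun l _ => eventually_reachWithin hA hH l _ _
  filter_upwards [hev] with s hs
  rw [distApprox, Finset.sum_congr rfl fun l hl => by rw [hs l hl], sum_range_gt,
    distanceFunction]
  have h₁ := hd p.unpair.1 p.unpair.2
  have h₂ := hH.dist_eq_zero_iff (u := p.unpair.1) (v := p.unpair.2)
  by_cases h : p.unpair.1 = p.unpair.2
  · simp [h]
  · have h₃ := fun h' => h (h₂.1 h')
    simp only [beq_eq_false_iff_ne.2 h, cond_false]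
    omega

end

/-! ### Spiders -/

/-! ### Distances under homomorphisms and lower bounds from Lipschitz functions -/

section Dist

variable {V W : Type*} {G : SimpleGraph V} {G' : SimpleGraph W}

theorem SimpleGraph.Connected.dist_map_le (hG : G.Connected) (φ : G →g G') (u v : V) :
    G'.dist (φ u) (φ v) ≤ G.dist u v := by
  obtain ⟨p, hp⟩ := hG.exists_walk_length_eq_dist u v
  rw [← hp, ← SimpleGraph.Walk.length_map φ p]
  exact SimpleGraph.dist_le _

theorem SimpleGraph.Connected.dist_iso (hG : G.Connected) (φ : G ≃g G') (u v : V) :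
    G'.dist (φ u) (φ v) = G.dist u v := by
  refine le_antisymm (hG.dist_map_le φ.toHom u v) ?_
  have := (φ.connected_iff.1 hG).dist_map_le φ.symm.toHom (φ u) (φ v)
  simpa using this

theorem SimpleGraph.Walk.le_add_length {F : V → ℕ} (hF : ∀ a b, G.Adj a b → F b ≤ F a + 1)
    {u v : V} (p : G.Walk u v) : F v ≤ F u + p.length := by
  induction p with
  | nil => simp
  | cons h p ih =>
    have := hF _ _ h
    rw [SimpleGraph.Walk.length_cons]
    omega

theorem SimpleGraph.Connected.le_add_dist (hG : G.Connected) {F : V → ℕ}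
    (hF : ∀ a b, G.Adj a b → F b ≤ F a + 1) (u v : V) : F v ≤ F u + G.dist u v := by
  obtain ⟨p, hp⟩ := hG.exists_walk_length_eq_dist u v
  exact hp ▸ p.le_add_length hF

end Dist

/-- The length of the legs of a spider of diameter at most `n + 2`. -/
def legLength (n : ℕ) : ℕ := (n + 1) / 2

/-- The oriented edges of a spider: the top of each leg is adjacent to the centre, two tops are
adjacent if `n` is odd, and two feet are adjacent if they are so in `E`. -/
def SpiderEdge {V : Type*} (n : ℕ) (E : SimpleGraph V) :
    Option (V × Fin (legLength n + 1)) → Option (V × Fin (legLength n + 1)) → Prop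
  | _, none => False
  | none, some (_, i) => (i : ℕ) = legLength n
  | some (v, i), some (w, j) => (v = w ∧ (j : ℕ) = i + 1) ∨
      (E.Adj v w ∧ (i : ℕ) = 0 ∧ (j : ℕ) = 0) ∨
      (n % 2 = 1 ∧ v ≠ w ∧ (i : ℕ) = legLength n ∧ (j : ℕ) = legLength n)

/-- The graph of diameter at most `n + 2` that arises from `E` by attaching to every vertex a leg
whose top is near to all other tops. -/
def spider {V : Type*} (n : ℕ) (E : SimpleGraph V) :
    SimpleGraph (Option (V × Fin (legLength n + 1))) :=
  SimpleGraph.fromRel (SpiderEdge n E)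

section Spider

variable {V W : Type*} {n : ℕ} {E : SimpleGraph V} {E' : SimpleGraph W}

/-- Isomorphic graphs have isomorphic spiders. -/
def spiderIso (n : ℕ) (φ : E ≃g E') : spider n E ≃g spider n E' where
  toEquiv := Equiv.optionCongr (φ.toEquiv.prodCongr (Equiv.refl _))
  map_rel_iff' := by
    have key : ∀ a b, SpiderEdge n E' (Equiv.optionCongr (φ.toEquiv.prodCongr (Equiv.refl _)) a)
        (Equiv.optionCongr (φ.toEquiv.prodCongr (Equiv.refl _)) b) ↔ SpiderEdge n E a b := by
      rintro (_ | ⟨v, i⟩) (_ | ⟨w, j⟩) <;> simp [SpiderEdge, φ.map_adj_iff]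
    intro a b
    simp only [spider, SimpleGraph.fromRel_adj, key, ne_eq, EmbeddingLike.apply_eq_iff_eq]

@[simp]
theorem spiderIso_some (φ : E ≃g E') (v : V) (i : Fin (legLength n + 1)) :
    spiderIso n φ (some (v, i)) = some (φ v, i) := rfl

theorem spider_adj_leg (v : V) {i j : Fin (legLength n + 1)} (h : (j : ℕ) = i + 1) :
    (spider n E).Adj (some (v, i)) (some (v, j)) := by
  refine (SimpleGraph.fromRel_adj _ _ _).2 ⟨?_, .inl (.inl ⟨rfl, h⟩)⟩
  simp only [ne_eq, Option.some.injEq, Prod.mk.injEq, true_and]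
  rintro rfl
  omega

theorem spider_adj_centre (v : V) : (spider n E).Adj (some (v, Fin.last _)) none :=
  (SimpleGraph.fromRel_adj _ _ _).2 ⟨by simp, .inr (by simp [SpiderEdge])⟩

theorem spider_adj_top (hn : n % 2 = 1) {v w : V} (h : v ≠ w) :
    (spider n E).Adj (some (v, Fin.last _)) (some (w, Fin.last _)) :=
  (SimpleGraph.fromRel_adj _ _ _).2 ⟨by simp [h], .inl (by simp [SpiderEdge, hn, h])⟩

theorem spider_adj_foot {v w : V} (h : E.Adj v w) :
    (spider n E).Adj (some (v, 0)) (some (w, 0)) :=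
  (SimpleGraph.fromRel_adj _ _ _).2 ⟨by simp [h.ne], .inl (by simp [SpiderEdge, h])⟩

theorem exists_walk_top (n : ℕ) (E : SimpleGraph V) (v : V) (i : Fin (legLength n + 1)) :
    ∃ p : (spider n E).Walk (some (v, i)) (some (v, Fin.last _)), p.length = legLength n - i := by
  induction i using Fin.reverseInduction with
  | last => exact ⟨.nil, by simp⟩
  | cast i ih =>
    obtain ⟨p, hp⟩ := ih
    refine ⟨.cons (spider_adj_leg v (by simp)) p, ?_⟩
    rw [SimpleGraph.Walk.length_cons, hp]
    simp only [Fin.val_succ, Fin.val_castSucc]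
    omega

theorem exists_walk_spider (n : ℕ) (E : SimpleGraph V) (a b) :
    ∃ p : (spider n E).Walk a b, p.length ≤ n + 2 := by
  have hc : ∀ v i, ∃ p : (spider n E).Walk (some (v, i)) none, p.length ≤ legLength n + 1 := by
    intro v i
    obtain ⟨p, hp⟩ := exists_walk_top n E v i
    refine ⟨p.concat (spider_adj_centre v), ?_⟩
    rw [SimpleGraph.Walk.length_concat]
    omega
  have hm : legLength n = (n + 1) / 2 := rfl
  rcases a with _ | ⟨v, i⟩ <;> rcases b with _ | ⟨w, j⟩
  · exact ⟨.nil, by simp⟩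
  · obtain ⟨p, hp⟩ := hc w j
    exact ⟨p.reverse, by rw [SimpleGraph.Walk.length_reverse]; omega⟩
  · obtain ⟨p, hp⟩ := hc v i
    exact ⟨p, by omega⟩
  · by_cases hn : n % 2 = 1
    · obtain ⟨p, hp⟩ := exists_walk_top n E v i
      obtain ⟨q, hq⟩ := exists_walk_top n E w j
      by_cases hvw : v = w
      · subst hvw
        exact ⟨p.append q.reverse, by
          rw [SimpleGraph.Walk.length_append, SimpleGraph.Walk.length_reverse]; omega⟩
      · exact ⟨(p.concat (spider_adj_top hn hvw)).append q.reverse, by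
          rw [SimpleGraph.Walk.length_append, SimpleGraph.Walk.length_reverse,
            SimpleGraph.Walk.length_concat]; omega⟩
    · obtain ⟨p, hp⟩ := hc v i
      obtain ⟨q, hq⟩ := hc w j
      exact ⟨p.append q.reverse, by
        rw [SimpleGraph.Walk.length_append, SimpleGraph.Walk.length_reverse]; omega⟩

theorem spider_connected (n : ℕ) (E : SimpleGraph V) : (spider n E).Connected :=
  (SimpleGraph.connected_iff _).2 ⟨fun a b => ⟨(exists_walk_spider n E a b).choose⟩, ⟨none⟩⟩

theorem spider_dist_le (n : ℕ) (E : SimpleGraph V) (a b) : (spider n E).dist a b ≤ n + 2 := by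
  obtain ⟨p, hp⟩ := exists_walk_spider n E a b
  exact (SimpleGraph.dist_le p).trans hp

/-- The legs do not spoil lower bounds below `n + 2`: a function that is 1-Lipschitz on `E`, cut off
at `n + 2`, extends to a 1-Lipschitz function on the spider. -/
theorem le_add_dist_spider {f : V → ℕ} (hf : ∀ v w, E.Adj v w → f w ≤ f v + 1) (v w : V) :
    min (f w) (n + 2) ≤ f v + (spider n E).dist (some (v, 0)) (some (w, 0)) := by
  have hm : legLength n = (n + 1) / 2 := rfl
  -- Going up a leg squeezes the values towards the middle of the range from 0 to `n + 2`. At the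
  -- tops they differ by at most 2 around the value of the centre if `n` is even, and by at most 1
  -- if `n` is odd, which is why tops may be adjacent then.
  let F : Option (V × Fin (legLength n + 1)) → ℕ
    | none => legLength n + 1
    | some (v, i) => min (f v + i) (n + 2 - i)
  have hF : ∀ a b, SpiderEdge n E a b → F b ≤ F a + 1 ∧ F a ≤ F b + 1 := by
    rintro (_ | ⟨v, i⟩) (_ | ⟨w, j⟩) h
    · exact h.elim
    · simp only [SpiderEdge] at h
      simp only [F]
      omega
    · exact h.elim
    · simp only [F]
      rcases h with ⟨rfl, h⟩ | ⟨h, hi, hj⟩ | ⟨hn, -, hi, hj⟩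
      · omega
      · have h₁ := hf _ _ h
        have h₂ := hf _ _ h.symm
        omega
      · omega
  have := (spider_connected n E).le_add_dist (F := F) (fun a b h =>
    ((SimpleGraph.fromRel_adj _ _ _).1 h).2.elim (fun h => (hF a b h).1) fun h => (hF b a h).2)
    (some (v, 0)) (some (w, 0))
  simp only [F, Fin.val_zero] at this
  omega

end Spider

/-! ### Gadgets -/

/-- The oriented edges of a gadget: slot `0` is its first endpoint, the slots `1, …, n + 1` form
a path that starts in its second endpoint, and slot `n + 2 + c` for `c < n` is a common neighbour
of slots `0` and `c + 1`. -/
def SlotEdge (n s t : ℕ) : Prop :=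
  (1 ≤ s ∧ t = s + 1 ∧ t ≤ n + 1) ∨ (s = 0 ∧ n + 2 ≤ t ∧ t < 2 * n + 2) ∨
    (1 ≤ s ∧ t = s + n + 1 ∧ t < 2 * n + 2)

/-- The slots that are present in a gadget of type `k`. For `k ≤ n` the endpoints are at distance
`k + 2`, gadgets of type `n + 1` are isolated vertices, the others are empty. -/
def HasSlot (n k s : ℕ) : Prop :=
  (k ≤ n ∧ (s ≤ n + 1 ∨ n + 2 + k ≤ s ∧ s < 2 * n + 2)) ∨ (k = n + 1 ∧ s = 2 * n + 2)

/-- The vertices of a disjoint union of gadgets of types `K 0, K 1, …`. -/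
abbrev GadgetVertex (n : ℕ) (K : ℕ → ℕ) : Type := {p : ℕ × ℕ // HasSlot n (K p.1) p.2}

/-- The disjoint union of gadgets of types `K 0, K 1, …`. -/
def gadgetGraph (n : ℕ) (K : ℕ → ℕ) : SimpleGraph (GadgetVertex n K) where
  Adj p q := p.1.1 = q.1.1 ∧ (SlotEdge n p.1.2 q.1.2 ∨ SlotEdge n q.1.2 p.1.2)
  symm := ⟨fun _ _ h => ⟨h.1.symm, h.2.symm⟩⟩
  loopless := ⟨fun _ h => by
    obtain ⟨-, h⟩ := h
    simp only [SlotEdge] at h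
    omega⟩

/-- A bijection of gadgets that preserves types induces an isomorphism. -/
def gadgetIso (n : ℕ) {K K' : ℕ → ℕ} (π : ℕ ≃ ℕ) (h : ∀ x, K' (π x) = K x) :
    gadgetGraph n K ≃g gadgetGraph n K' where
  toEquiv := (π.prodCongr (Equiv.refl ℕ)).subtypeEquiv fun p => by simp [h]
  map_rel_iff' := by
    intro p q
    simp [gadgetGraph]

@[simp]
theorem gadgetIso_fst {n : ℕ} {K K' : ℕ → ℕ} {π : ℕ ≃ ℕ} (h : ∀ x, K' (π x) = K x)
    (p : GadgetVertex n K) : (gadgetIso n π h p).1.1 = π p.1.1 := rfl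

@[simp]
theorem gadgetIso_snd {n : ℕ} {K K' : ℕ → ℕ} {π : ℕ ≃ ℕ} (h : ∀ x, K' (π x) = K x)
    (p : GadgetVertex n K) : (gadgetIso n π h p).1.2 = p.1.2 := rfl

theorem spider_adj_slot {n : ℕ} {K : ℕ → ℕ} {x s t : ℕ} (hs : HasSlot n (K x) s)
    (ht : HasSlot n (K x) t) (h : SlotEdge n s t ∨ SlotEdge n t s) :
    (spider n (gadgetGraph n K)).Adj (some (⟨(x, s), hs⟩, 0)) (some (⟨(x, t), ht⟩, 0)) :=
  spider_adj_foot (E := gadgetGraph n K) (v := ⟨(x, s), hs⟩) (w := ⟨(x, t), ht⟩) ⟨rfl, h⟩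

theorem exists_walk_path {n : ℕ} {K : ℕ → ℕ} {x j : ℕ} (hj : j ≤ n)
    (h : HasSlot n (K x) (j + 1)) (h₁ : HasSlot n (K x) 1) :
    ∃ p : (spider n (gadgetGraph n K)).Walk (some (⟨(x, j + 1), h⟩, 0)) (some (⟨(x, 1), h₁⟩, 0)),
      p.length = j := by
  induction j with
  | zero => exact ⟨.nil, rfl⟩
  | succ j ih =>
    have h' : HasSlot n (K x) (j + 1) := by
      simp only [HasSlot] at h ⊢
      omega
    obtain ⟨p, hp⟩ := ih (by omega) h'
    exact ⟨.cons (spider_adj_slot h h' (.inr (.inl (by omega)))) p, by simp [hp]⟩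

theorem dist_endpoints {n : ℕ} {K : ℕ → ℕ} {x : ℕ} (hx : K x ≤ n) (h₀ : HasSlot n (K x) 0)
    (h₁ : HasSlot n (K x) 1) :
    (spider n (gadgetGraph n K)).dist (some (⟨(x, 0), h₀⟩, 0)) (some (⟨(x, 1), h₁⟩, 0)) =
      K x + 2 := by
  refine le_antisymm ?_ ?_
  -- For type `n` there is no connecting slot and the route runs through the legs. Otherwise slot `n
  -- + 2 + K x` leads to slot `K x + 1`, and the path leads back to slot 1.
  · rcases hx.eq_or_lt with hx' | hx'
    · rw [hx']
      exact spider_dist_le n _ _ _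
    · have hq : HasSlot n (K x) (n + 2 + K x) := by
        simp only [HasSlot]
        omega
      have hb : HasSlot n (K x) (K x + 1) := by
        simp only [HasSlot]
        omega
      obtain ⟨p, hp⟩ := exists_walk_path hx hb h₁
      exact (SimpleGraph.dist_le (.cons (spider_adj_slot h₀ hq (.inl (.inr (.inl (by omega)))))
        (.cons (spider_adj_slot hq hb (.inr (.inr (.inr (by omega))))) p))).trans (by simp [hp])
  -- A 1-Lipschitz lower bound for the distance from slot 0 within the gadget; path vertices at or
  -- beyond the first connection get 2. The value elsewhere is immaterial, as gadgets are not joined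
  -- to each other.
  · let f : GadgetVertex n K → ℕ := fun p =>
      if p.1.1 = x then
        if p.1.2 = 0 then 0 else if p.1.2 ≤ n + 1 then 2 + (K x - (p.1.2 - 1)) else 1
      else n + 2
    have hf : ∀ v w, (gadgetGraph n K).Adj v w → f w ≤ f v + 1 := by
      rintro ⟨⟨y, s⟩, hs⟩ ⟨⟨z, t⟩, ht⟩ ⟨hyz, h⟩
      simp only at hyz h hs ht
      subst hyz
      simp only [f]
      by_cases hy : y = x
      · subst hy
        simp only [SlotEdge, HasSlot] at h hs ht
        split_ifs <;> omega
      · simp [hy]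
    have := le_add_dist_spider (n := n) hf ⟨(x, 0), h₀⟩ ⟨(x, 1), h₁⟩
    simp [f] at this
    omega

/-- Two transpositions suffice: one moves `x` to `x'`, the next corrects the image of `y` without
disturbing `x'`. -/
theorem exists_perm_of_fiber {K : ℕ → ℕ} {x y x' y' : ℕ} (hx : K x = K x') (hy : K y = K y')
    (hxy : x = y ↔ x' = y') :
    ∃ π : Equiv.Perm ℕ, (∀ z, K (π z) = K z) ∧ π x = x' ∧ π y = y' := by
  have hswap : ∀ {a b : ℕ}, K a = K b → ∀ z, K (Equiv.swap a b z) = K z := by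
    intro a b hab z
    rw [Equiv.swap_apply_def]
    split_ifs with h₁ h₂
    · rw [h₁, hab]
    · rw [h₂, hab]
    · rfl
  have hz : K (Equiv.swap x x' y) = K y' := by rw [hswap hx, hy]
  refine ⟨Equiv.swap (Equiv.swap x x' y) y' * Equiv.swap x x', fun z => ?_, ?_, ?_⟩
  · rw [Equiv.Perm.mul_apply, hswap hz, hswap hx]
  · rw [Equiv.Perm.mul_apply, Equiv.swap_apply_left]
    by_cases h : x = y
    · subst h
      rw [Equiv.swap_apply_left, ← hxy.1 rfl, Equiv.swap_self, Equiv.refl_apply]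
    · refine Equiv.swap_apply_of_ne_of_ne (fun h' => h ?_) fun h' => h (hxy.2 h')
      have := congrArg (Equiv.swap x x') h'
      simpa using this
  · rw [Equiv.Perm.mul_apply, Equiv.swap_apply_left]

/-- The height, the type of the gadget and the slot of a vertex of a spider. -/
def vertexType {n : ℕ} {K : ℕ → ℕ} :
    Option (GadgetVertex n K × Fin (legLength n + 1)) → ℕ × ℕ × ℕ
  | none => (legLength n + 1, 0, 0)
  | some (p, i) => (i, K p.1.1, p.1.2)

/-- The gadget of a vertex of a spider. -/
def gadgetOf {n : ℕ} {K : ℕ → ℕ} : Option (GadgetVertex n K × Fin (legLength n + 1)) → ℕ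
  | none => 0
  | some (p, _) => p.1.1

theorem eq_of_vertexType {n : ℕ} {K : ℕ → ℕ} {π : ℕ ≃ ℕ} (h : ∀ x, K (π x) = K x)
    {a a' : Option (GadgetVertex n K × Fin (legLength n + 1))}
    (ht : vertexType a = vertexType a') (hg : a ≠ none → π (gadgetOf a) = gadgetOf a') :
    spiderIso n (gadgetIso n π h) a = a' := by
  rcases a with _ | ⟨p, i⟩ <;> rcases a' with _ | ⟨p', i'⟩
  · rfl
  · have := congrArg Prod.fst ht
    simp only [vertexType] at this
    omega
  · have := congrArg Prod.fst ht
    simp only [vertexType] at this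
    omega
  · have hg := hg (by simp)
    simp only [vertexType, Prod.mk.injEq, gadgetOf] at ht hg
    rw [spiderIso_some, Option.some.injEq, Prod.mk.injEq]
    refine ⟨Subtype.ext (Prod.ext ?_ ?_), Fin.ext ht.1⟩
    · rw [gadgetIso_fst, hg]
    · rw [gadgetIso_snd, ht.2.2]

theorem type_gadgetOf_eq {n : ℕ} {K : ℕ → ℕ}
    {a a' : Option (GadgetVertex n K × Fin (legLength n + 1))}
    (ht : vertexType a = vertexType a') : K (gadgetOf a) = K (gadgetOf a') := by
  rcases a with _ | ⟨p, i⟩ <;> rcases a' with _ | ⟨p', i'⟩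
  · rfl
  · have := congrArg Prod.fst ht
    simp only [vertexType] at this
    omega
  · have := congrArg Prod.fst ht
    simp only [vertexType] at this
    omega
  · simp only [vertexType, Prod.mk.injEq] at ht
    exact ht.2.1

/-- Some automorphism carries one pair to the other. The centre is fixed by all of them, so its
dummy gadget 0 has to be excluded from the comparison. -/
theorem dist_eq_of_vertexType {n : ℕ} {K : ℕ → ℕ}
    {a b a' b' : Option (GadgetVertex n K × Fin (legLength n + 1))}
    (ha : vertexType a = vertexType a') (hb : vertexType b = vertexType b')
    (hab : a ≠ none → b ≠ none → (gadgetOf a = gadgetOf b ↔ gadgetOf a' = gadgetOf b')) :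
    (spider n (gadgetGraph n K)).dist a b = (spider n (gadgetGraph n K)).dist a' b' := by
  obtain ⟨π, hπ, h₁, h₂⟩ : ∃ π : Equiv.Perm ℕ, (∀ z, K (π z) = K z) ∧
      (a ≠ none → π (gadgetOf a) = gadgetOf a') ∧ (b ≠ none → π (gadgetOf b) = gadgetOf b') := by
    have hKa := type_gadgetOf_eq ha
    have hKb := type_gadgetOf_eq hb
    by_cases ha₀ : a = none
    · obtain ⟨π, hπ, h, -⟩ := exists_perm_of_fiber hKb hKb (by simp)
      exact ⟨π, hπ, fun h' => (h' ha₀).elim, fun _ => h⟩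
    · by_cases hb₀ : b = none
      · obtain ⟨π, hπ, h, -⟩ := exists_perm_of_fiber hKa hKa (by simp)
        exact ⟨π, hπ, fun _ => h, fun h' => (h' hb₀).elim⟩
      · obtain ⟨π, hπ, h, h'⟩ := exists_perm_of_fiber hKa hKb (hab ha₀ hb₀)
        exact ⟨π, hπ, fun _ => h, fun _ => h'⟩
  rw [← eq_of_vertexType hπ ha h₁, ← eq_of_vertexType hπ hb h₂]
  exact ((spider_connected n _).dist_iso _ a b).symm

/-! ### The computable copy given by a family of counters -/

/-- The slot of the gadget vertex coded by `e`: the vertex `pair x t` belongs to gadget `x`; for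
`t ≤ n + 1` it fills slot `t`, and for larger `t` a slot according to the behaviour of the
counter `C x` at stage `t - (n + 2)`, where `2 * n + 2` stands for an isolated vertex. -/
def slotAt (n : ℕ) (C : ℕ → ℕ → ℕ) (e : ℕ) : ℕ :=
  if e.unpair.2 < n + 2 then e.unpair.2
  else if C e.unpair.1 (e.unpair.2 - (n + 2)) = C e.unpair.1 (e.unpair.2 - (n + 2) + 1) then
    2 * n + 2
  else n + 2 + C e.unpair.1 (e.unpair.2 - (n + 2) + 1)

/-- The index of the gadget of `e`, where isolated vertices form gadgets of their own. -/
def gadgetIndex (n : ℕ) (C : ℕ → ℕ → ℕ) (e : ℕ) : ℕ :=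
  if slotAt n C e = 2 * n + 2 then 2 * e + 1 else 2 * e.unpair.1

/-- The types of the gadgets, if the counter `C x` has the final value `k x`. -/
def gadgetType (n : ℕ) (C : ℕ → ℕ → ℕ) (k : ℕ → ℕ) (y : ℕ) : ℕ :=
  if y % 2 = 0 then k (y / 2) else if slotAt n C (y / 2) = 2 * n + 2 then n + 1 else n + 2

theorem gadgetType_gadgetIndex (n : ℕ) (C : ℕ → ℕ → ℕ) (k : ℕ → ℕ) (e : ℕ) :
    gadgetType n C k (gadgetIndex n C e) =
      if slotAt n C e = 2 * n + 2 then n + 1 else k e.unpair.1 := by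
  unfold gadgetIndex gadgetType
  split_ifs with h h₁ h₂ h₃ h₄
  · omega
  · rfl
  · rw [show (2 * e + 1) / 2 = e by omega] at h₂
    exact (h₂ h).elim
  · rw [Nat.mul_div_cancel_left _ two_pos]
  · omega
  · omega

section Copy

variable {n : ℕ} {C : ℕ → ℕ → ℕ}

theorem slotAt_of_lt {x t : ℕ} (ht : t < n + 2) : slotAt n C (Nat.pair x t) = t := by
  simp [slotAt, ht]

theorem slotAt_of_drop {x s : ℕ} (hs : C x s ≠ C x (s + 1)) :
    slotAt n C (Nat.pair x (n + 2 + s)) = n + 2 + C x (s + 1) := by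
  simp [slotAt, hs]

theorem slotAt_of_const {x s : ℕ} (hs : C x s = C x (s + 1)) :
    slotAt n C (Nat.pair x (n + 2 + s)) = 2 * n + 2 := by
  simp [slotAt, hs]

theorem lt_of_drop (hC : ∀ x, IsCounter n (C x)) {x s : ℕ} (hs : C x s ≠ C x (s + 1)) :
    C x (s + 1) < n := by
  have h₁ := (hC x).step s
  have h₂ := (hC x).le s
  omega

variable (hC : ∀ x, IsCounter n (C x))

theorem hasSlot_slotAt (e : ℕ) :
    HasSlot n (gadgetType n C (fun x => (hC x).limit) (gadgetIndex n C e)) (slotAt n C e) := by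
  rw [gadgetType_gadgetIndex]
  obtain ⟨x, t, rfl⟩ : ∃ x t, e = Nat.pair x t := ⟨_, _, (Nat.pair_unpair e).symm⟩
  rw [Nat.unpair_pair]
  have hk := (hC x).limit_le_start
  by_cases ht : t < n + 2
  · rw [slotAt_of_lt ht, if_neg (by omega)]
    exact .inl ⟨hk, .inl (by omega)⟩
  · obtain ⟨s, rfl⟩ := Nat.exists_eq_add_of_le (not_lt.1 ht)
    by_cases hs : C x s = C x (s + 1)
    · rw [slotAt_of_const hs, if_pos rfl]
      exact .inr ⟨rfl, rfl⟩
    · have h₁ := lt_of_drop hC hs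
      have h₂ := (hC x).limit_le (s + 1)
      rw [slotAt_of_drop hs, if_neg (by omega)]
      exact .inl ⟨hk, .inr (by omega)⟩

/-- The gadget vertex coded by a natural number. -/
noncomputable def toGadgetVertex (e : ℕ) :
    GadgetVertex n (gadgetType n C fun x => (hC x).limit) :=
  ⟨(gadgetIndex n C e, slotAt n C e), hasSlot_slotAt hC e⟩

/-- Isolated vertices carry their own code as index; a connecting slot determines its stage because
a counter enters each value at most once. -/
theorem toGadgetVertex_injective : Function.Injective (toGadgetVertex hC) := by
  intro e e' h
  have h := congrArg Subtype.val h
  simp only [toGadgetVertex, Prod.mk.injEq] at h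
  obtain ⟨h₁, h₂⟩ := h
  unfold gadgetIndex at h₁
  rw [← h₂] at h₁
  split_ifs at h₁ with hd
  · omega
  · obtain ⟨x, t, rfl⟩ : ∃ x t, e = Nat.pair x t := ⟨_, _, (Nat.pair_unpair e).symm⟩
    obtain ⟨x', t', rfl⟩ : ∃ x t, e' = Nat.pair x t := ⟨_, _, (Nat.pair_unpair e').symm⟩
    simp only [Nat.unpair_pair] at h₁
    obtain rfl : x = x' := by omega
    congr 1
    by_cases ht : t < n + 2 <;> by_cases ht' : t' < n + 2
    · rwa [slotAt_of_lt ht, slotAt_of_lt ht'] at h₂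
    · obtain ⟨s', rfl⟩ := Nat.exists_eq_add_of_le (not_lt.1 ht')
      by_cases hs' : C x s' = C x (s' + 1)
      · exact (hd (h₂.trans (slotAt_of_const hs'))).elim
      · rw [slotAt_of_lt ht, slotAt_of_drop hs'] at h₂
        omega
    · obtain ⟨s, rfl⟩ := Nat.exists_eq_add_of_le (not_lt.1 ht)
      by_cases hs : C x s = C x (s + 1)
      · exact (hd (slotAt_of_const hs)).elim
      · rw [slotAt_of_lt ht', slotAt_of_drop hs] at h₂
        omega
    · obtain ⟨s, rfl⟩ := Nat.exists_eq_add_of_le (not_lt.1 ht)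
      obtain ⟨s', rfl⟩ := Nat.exists_eq_add_of_le (not_lt.1 ht')
      by_cases hs : C x s = C x (s + 1)
      · exact (hd (slotAt_of_const hs)).elim
      by_cases hs' : C x s' = C x (s' + 1)
      · exact (hd (h₂.trans (slotAt_of_const hs'))).elim
      rw [slotAt_of_drop hs, slotAt_of_drop hs'] at h₂
      rw [(hC x).drop_unique hs hs' (by omega)]

/-- Each connecting slot of the final type is filled, because the counter passes through every value
from its limit to `n - 1`. -/
theorem toGadgetVertex_surjective : Function.Surjective (toGadgetVertex hC) := by
  rintro ⟨⟨y, s⟩, h⟩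
  have main : ∀ e, slotAt n C e = s → gadgetIndex n C e = y →
      ∃ e, toGadgetVertex hC e = ⟨(y, s), h⟩ :=
    fun e h₁ h₂ => ⟨e, Subtype.ext (Prod.ext h₂ h₁)⟩
  obtain ⟨x, rfl | rfl⟩ := Nat.even_or_odd' y
  · have hk := (hC x).limit_le_start
    have hx : ∀ t, slotAt n C (Nat.pair x t) = s → s < 2 * n + 2 →
        ∃ e, toGadgetVertex hC e = ⟨(2 * x, s), h⟩ := by
      intro t h₁ h₂
      refine main _ h₁ ?_
      rw [gadgetIndex, if_neg (by omega), Nat.unpair_pair]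
    have h' := h
    simp only [gadgetType, HasSlot, Nat.mul_mod_right, if_true,
      Nat.mul_div_cancel_left _ two_pos] at h'
    rcases h' with ⟨-, h' | h'⟩ | h'
    · by_cases hn : s < 2 * n + 2
      · exact hx s (slotAt_of_lt (by omega)) hn
      · omega
    · obtain ⟨c, rfl⟩ := Nat.exists_eq_add_of_le (show n + 2 ≤ s by omega)
      obtain ⟨t, h₁, h₂⟩ := (hC x).exists_drop (c := c) (by omega) (by omega)
      exact hx (n + 2 + t) (by rw [slotAt_of_drop h₁, h₂]) (by omega)
    · omega
  · have h' := h
    simp only [gadgetType, HasSlot, show (2 * x + 1) % 2 ≠ 0 by omega, if_false,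
      show (2 * x + 1) / 2 = x by omega] at h'
    split_ifs at h' with hd
    · obtain rfl : s = 2 * n + 2 := by omega
      exact main x hd (by rw [gadgetIndex, if_pos hd])
    · omega

/-- The bijection between the natural numbers and the vertices of the spider. -/
noncomputable def vertexEquiv :
    ℕ ≃ Option (GadgetVertex n (gadgetType n C fun x => (hC x).limit) ×
      Fin (legLength n + 1)) :=
  (Denumerable.eqv (Option ℕ)).symm.trans (Equiv.optionCongr
    ((Nat.divModEquiv (legLength n + 1)).trans ((Equiv.ofBijective (toGadgetVertex hC)
      ⟨toGadgetVertex_injective hC, toGadgetVertex_surjective hC⟩).prodCongr (Equiv.refl _))))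

theorem vertexEquiv_zero : vertexEquiv hC 0 = none := rfl

theorem vertexEquiv_succ (u : ℕ) : vertexEquiv hC (u + 1) =
    some (toGadgetVertex hC (u / (legLength n + 1)), Fin.ofNat _ u) := rfl

/-- The copy of the spider over the gadgets that is given by a family of counters. -/
noncomputable def copyGraph : SimpleGraph ℕ :=
  (spider n (gadgetGraph n (gadgetType n C fun x => (hC x).limit))).comap (vertexEquiv hC)

/-- The isomorphism between the copy and the spider. -/
noncomputable def copyIso : copyGraph hC ≃g
    spider n (gadgetGraph n (gadgetType n C fun x => (hC x).limit)) :=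
  SimpleGraph.Iso.comap (vertexEquiv hC) _

theorem copyGraph_connected : (copyGraph hC).Connected :=
  (copyIso hC).connected_iff.2 (spider_connected n _)

theorem copyGraph_dist (u v : ℕ) : (copyGraph hC).dist u v =
    (spider n (gadgetGraph n (gadgetType n C fun x => (hC x).limit))).dist
      (vertexEquiv hC u) (vertexEquiv hC v) :=
  ((copyGraph_connected hC).dist_iso (copyIso hC) u v).symm

end Copy

/-! ### Isomorphism of the copies -/

section Iso

variable {n : ℕ}

/-- Once counter 0 has settled, each further stage contributes an isolated vertex. -/
theorem infinite_gadgetType_of_lt {C : ℕ → ℕ → ℕ} (hC : ∀ x, IsCounter n (C x)) :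
    {y | gadgetType n C (fun x => (hC x).limit) y = n + 1}.Infinite := by
  obtain ⟨s₀, hs₀⟩ := Filter.eventually_atTop.1 (hC 0).eventually_eq_limit
  refine Set.infinite_of_injective_forall_mem
    (f := fun s => 2 * Nat.pair 0 (n + 2 + (s₀ + s)) + 1) ?_ fun s => ?_
  · intro s t h
    have := (Nat.pair_eq_pair.1 (show Nat.pair 0 (n + 2 + (s₀ + s)) =
      Nat.pair 0 (n + 2 + (s₀ + t)) by simpa using h)).2
    omega
  · have hs : C 0 (s₀ + s) = C 0 (s₀ + s + 1) := by
      rw [hs₀ _ (by omega), hs₀ _ (by omega)]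
    have := slotAt_of_const (n := n) hs
    generalize Nat.pair 0 (n + 2 + (s₀ + s)) = e at this
    simp only [Set.mem_ofPred_eq, gadgetType, show (2 * e + 1) % 2 ≠ 0 by omega, if_false,
      show (2 * e + 1) / 2 = e by omega, this, if_true]

/-- The codes `Nat.pair x 0` fill slot 0 of ordinary gadgets, so the odd indices reserved for them
stay empty. -/
theorem infinite_gadgetType_empty {C : ℕ → ℕ → ℕ} (k : ℕ → ℕ) :
    {y | gadgetType n C k y = n + 2}.Infinite := by
  refine Set.infinite_of_injective_forall_mem (f := fun x => 2 * Nat.pair x 0 + 1) ?_ fun x => ?_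
  · intro x y h
    exact (Nat.pair_eq_pair.1 (show Nat.pair x 0 = Nat.pair y 0 by simpa using h)).1
  · have : slotAt n C (Nat.pair x 0) = 0 := slotAt_of_lt (by omega)
    generalize Nat.pair x 0 = e at this
    simp [gadgetType, show (2 * e + 1) / 2 = e by omega, this]

theorem infinite_gadgetType_of_le {C : ℕ → ℕ → ℕ} {k : ℕ → ℕ} {j : ℕ}
    (h : {x | k x = j}.Infinite) : {y | gadgetType n C k y = j}.Infinite := by
  refine (h.image (f := fun x => 2 * x) fun x _ y _ h => by simpa using h).mono ?_
  rintro _ ⟨x, hx, rfl⟩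
  simpa [gadgetType] using hx

theorem gadgetType_le {C : ℕ → ℕ → ℕ} (hC : ∀ x, IsCounter n (C x)) (y : ℕ) :
    gadgetType n C (fun x => (hC x).limit) y ≤ n + 2 := by
  have := (hC (y / 2)).limit_le_start
  unfold gadgetType
  beta_reduce
  split_ifs <;> omega

theorem infinite_gadgetType {C : ℕ → ℕ → ℕ} (hC : ∀ x, IsCounter n (C x))
    (h : ∀ j ≤ n, {x | (hC x).limit = j}.Infinite) {j : ℕ} (hj : j ≤ n + 2) :
    {y | gadgetType n C (fun x => (hC x).limit) y = j}.Infinite := by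
  rcases (show j ≤ n ∨ j = n + 1 ∨ j = n + 2 by omega) with hj | rfl | rfl
  · exact infinite_gadgetType_of_le (h j hj)
  · exact infinite_gadgetType_of_lt hC
  · exact infinite_gadgetType_empty _

/-- Two families of counters that attain each final value infinitely often give isomorphic
copies. -/
theorem nonempty_copyGraph_iso {C C' : ℕ → ℕ → ℕ} (hC : ∀ x, IsCounter n (C x))
    (hC' : ∀ x, IsCounter n (C' x)) (h : ∀ j ≤ n, {x | (hC x).limit = j}.Infinite)
    (h' : ∀ j ≤ n, {x | (hC' x).limit = j}.Infinite) :
    Nonempty (copyGraph hC ≃g copyGraph hC') := by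
  -- Matching the fibres of the two type functions yields a type-preserving permutation of the
  -- indices: the fibres are countably infinite up to `n + 2` and empty beyond.
  have e : ∀ j, Nonempty ({y // gadgetType n C (fun x => (hC x).limit) y = j} ≃
      {y // gadgetType n C' (fun x => (hC' x).limit) y = j}) := by
    intro j
    by_cases hj : j ≤ n + 2
    · have := (infinite_gadgetType hC h hj).to_subtype
      have := (infinite_gadgetType hC' h' hj).to_subtype
      exact nonempty_equiv_of_countable (α := {y | gadgetType n C _ y = j})
        (β := {y | gadgetType n C' _ y = j})
    · have : IsEmpty {y // gadgetType n C (fun x => (hC x).limit) y = j} :=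
        ⟨fun y => hj (y.2 ▸ gadgetType_le hC y)⟩
      have : IsEmpty {y // gadgetType n C' (fun x => (hC' x).limit) y = j} :=
        ⟨fun y => hj (y.2 ▸ gadgetType_le hC' y)⟩
      exact ⟨Equiv.equivOfIsEmpty _ _⟩
  have hπ := Equiv.ofFiberEquiv_map fun j => (e j).some
  exact ⟨(copyIso hC).trans ((spiderIso n (gadgetIso n _ hπ)).trans (copyIso hC').symm)⟩

end Iso

/-! ### Computability of the copies -/

section Computability

variable {n : ℕ} {C : ℕ → ℕ → ℕ}

theorem PrimrecPred.computablePred_comp {α β : Type*} [Primcodable α] [Primcodable β]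
    {P : β → Prop} (hP : PrimrecPred P) {f : α → β} (hf : Computable f) :
    ComputablePred fun a => P (f a) := by
  classical
  exact ⟨inferInstance, hP.decide.to_comp.comp hf⟩

theorem computable_slotAt (hc : Computable₂ C) : Computable (slotAt n C) := by
  have h : Primrec fun p : ℕ × ℕ × ℕ => if p.1 < n + 2 then p.1
      else if p.2.1 = p.2.2 then 2 * n + 2 else n + 2 + p.2.2 := by
    have h₂ := Primrec.snd.comp (Primrec.snd (α := ℕ) (β := ℕ × ℕ))
    exact Primrec.ite (Primrec.nat_lt.comp Primrec.fst (Primrec.const _)) Primrec.fst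
      (Primrec.ite (Primrec.eq.comp (Primrec.fst.comp Primrec.snd) h₂) (Primrec.const _)
        (Primrec.nat_add.comp (Primrec.const _) h₂))
  have hx : Computable fun e : ℕ => e.unpair.1 := Computable.fst.comp Computable.unpair
  have ht : Computable fun e : ℕ => e.unpair.2 := Computable.snd.comp Computable.unpair
  have hs : Computable fun e : ℕ => e.unpair.2 - (n + 2) :=
    Primrec.nat_sub.to_comp.comp ht (Computable.const _)
  exact h.to_comp.comp (ht.pair ((hc.comp hx hs).pair (hc.comp hx (Computable.succ.comp hs))))

theorem computable_gadgetIndex (hc : Computable₂ C) : Computable (gadgetIndex n C) := by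
  have h : Primrec fun p : ℕ × ℕ =>
      if p.2 = 2 * n + 2 then 2 * p.1 + 1 else 2 * p.1.unpair.1 :=
    Primrec.ite (Primrec.eq.comp Primrec.snd (Primrec.const _))
      (Primrec.succ.comp (Primrec.nat_mul.comp (Primrec.const _) Primrec.fst))
      (Primrec.nat_mul.comp (Primrec.const _)
        (Primrec.fst.comp (Primrec.unpair.comp Primrec.fst)))
  exact h.to_comp.comp (Computable.id.pair (computable_slotAt hc))

/-- The gadget vertex whose leg contains the vertex `u ≠ 0`. -/
def legOf (n u : ℕ) : ℕ := (u - 1) / (legLength n + 1)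

/-- The height of the vertex `u ≠ 0` in its leg. -/
def heightOf (n u : ℕ) : ℕ := (u - 1) % (legLength n + 1)

theorem primrec_legOf (n : ℕ) : Primrec (legOf n) :=
  Primrec.nat_div.comp Primrec.pred (Primrec.const _)

theorem primrec_heightOf (n : ℕ) : Primrec (heightOf n) :=
  Primrec.nat_mod.comp Primrec.pred (Primrec.const _)

theorem vertexEquiv_of_ne_zero (hC : ∀ x, IsCounter n (C x)) {u : ℕ} (hu : u ≠ 0) :
    vertexEquiv hC u = some (toGadgetVertex hC (legOf n u), Fin.ofNat _ (u - 1)) := by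
  obtain ⟨u, rfl⟩ := Nat.exists_eq_succ_of_ne_zero hu
  rfl

/-- The oriented edges of the copy in terms of the name of a vertex, its leg, its height, and the
gadget and the slot of its leg. -/
def DataEdge (n : ℕ) (a b : ℕ × ℕ × ℕ × ℕ × ℕ) : Prop :=
  b.1 ≠ 0 ∧ ((a.1 = 0 ∧ b.2.2.1 = legLength n) ∨ (a.1 ≠ 0 ∧
    ((a.2.1 = b.2.1 ∧ b.2.2.1 = a.2.2.1 + 1) ∨
      ((a.2.2.2.1 = b.2.2.2.1 ∧
        (SlotEdge n a.2.2.2.2 b.2.2.2.2 ∨ SlotEdge n b.2.2.2.2 a.2.2.2.2)) ∧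
          a.2.2.1 = 0 ∧ b.2.2.1 = 0) ∨
      (n % 2 = 1 ∧ a.2.1 ≠ b.2.1 ∧ a.2.2.1 = legLength n ∧ b.2.2.1 = legLength n))))

/-- The data of a vertex on which adjacency depends. -/
def vertexData (n : ℕ) (C : ℕ → ℕ → ℕ) (u : ℕ) : ℕ × ℕ × ℕ × ℕ × ℕ :=
  (u, legOf n u, heightOf n u, gadgetIndex n C (legOf n u), slotAt n C (legOf n u))

theorem copyGraph_adj (hC : ∀ x, IsCounter n (C x)) (u v : ℕ) : (copyGraph hC).Adj u v ↔
    u ≠ v ∧ (DataEdge n (vertexData n C u) (vertexData n C v) ∨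
      DataEdge n (vertexData n C v) (vertexData n C u)) := by
  have key : ∀ u v, SpiderEdge n (gadgetGraph n (gadgetType n C fun x => (hC x).limit))
      (vertexEquiv hC u) (vertexEquiv hC v) ↔
        DataEdge n (vertexData n C u) (vertexData n C v) := by
    intro u v
    by_cases hv : v = 0
    · subst hv
      rw [vertexEquiv_zero]
      simp [SpiderEdge, DataEdge, vertexData]
    · rw [vertexEquiv_of_ne_zero hC hv]
      by_cases hu : u = 0
      · subst hu
        rw [vertexEquiv_zero]
        simp [SpiderEdge, DataEdge, vertexData, hv, heightOf]
      · rw [vertexEquiv_of_ne_zero hC hu]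
        simp only [SpiderEdge, DataEdge, (toGadgetVertex_injective hC).eq_iff, ne_eq]
        simp [vertexData, hv, hu, heightOf, gadgetGraph, toGadgetVertex]
  rw [copyGraph, SimpleGraph.comap_adj, spider, SimpleGraph.fromRel_adj, key, key,
    (vertexEquiv hC).injective.ne_iff]

theorem primrecRel_slotEdge (n : ℕ) : PrimrecRel (SlotEdge n) := by
  have hs := Primrec.fst (α := ℕ) (β := ℕ)
  have ht := Primrec.snd (α := ℕ) (β := ℕ)
  have h₁ := Primrec.nat_le.comp (Primrec.const 1) hs
  have h₂ := Primrec.nat_lt.comp ht (Primrec.const (2 * n + 2))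
  refine .or (.and h₁ (.and ?_ ?_)) (.or (.and ?_ (.and ?_ h₂)) (.and h₁ (.and ?_ h₂)))
  · exact Primrec.eq.comp ht (Primrec.succ.comp hs)
  · exact Primrec.nat_le.comp ht (Primrec.const _)
  · exact Primrec.eq.comp hs (Primrec.const _)
  · exact Primrec.nat_le.comp (Primrec.const _) ht
  · exact Primrec.eq.comp ht (Primrec.succ.comp (Primrec.nat_add.comp hs (Primrec.const _)))

theorem primrecRel_dataEdge (n : ℕ) : PrimrecRel (DataEdge n) := by
  have p₁ := Primrec.fst (α := ℕ) (β := ℕ × ℕ × ℕ × ℕ)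
  have q₁ := Primrec.snd (α := ℕ) (β := ℕ × ℕ × ℕ × ℕ)
  have p₂ := Primrec.fst.comp q₁
  have q₂ := Primrec.snd.comp q₁
  have p₃ := Primrec.fst.comp q₂
  have q₃ := Primrec.snd.comp q₂
  have p₄ := Primrec.fst.comp q₃
  have p₅ := Primrec.snd.comp q₃
  have a := Primrec.fst (α := ℕ × ℕ × ℕ × ℕ × ℕ) (β := ℕ × ℕ × ℕ × ℕ × ℕ)
  have b := Primrec.snd (α := ℕ × ℕ × ℕ × ℕ × ℕ) (β := ℕ × ℕ × ℕ × ℕ × ℕ)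
  have c := fun k : ℕ => Primrec.const (α := (ℕ × ℕ × ℕ × ℕ × ℕ) × (ℕ × ℕ × ℕ × ℕ × ℕ)) k
  have e : ∀ {f g : (ℕ × ℕ × ℕ × ℕ × ℕ) × (ℕ × ℕ × ℕ × ℕ × ℕ) → ℕ}, Primrec f → Primrec g →
      PrimrecPred fun p => f p = g p := fun hf hg => Primrec.eq.comp hf hg
  have s := primrecRel_slotEdge n
  refine .and (.not (e (p₁.comp b) (c 0))) (.or (.and (e (p₁.comp a) (c 0))
    (e (p₃.comp b) (c _))) (.and (.not (e (p₁.comp a) (c 0))) (.or (.and (e (p₂.comp a)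
    (p₂.comp b)) (e (p₃.comp b) (Primrec.succ.comp (p₃.comp a)))) (.or (.and (.and
    (e (p₄.comp a) (p₄.comp b)) (.or (s.comp (p₅.comp a) (p₅.comp b))
    (s.comp (p₅.comp b) (p₅.comp a)))) (.and (e (p₃.comp a) (c 0)) (e (p₃.comp b) (c 0))))
    (.and (e (c (n % 2)) (c 1)) (.and (.not (e (p₂.comp a) (p₂.comp b))) (.and
    (e (p₃.comp a) (c _)) (e (p₃.comp b) (c _)))))))))

theorem computable_vertexData (hc : Computable₂ C) : Computable (vertexData n C) :=
  Computable.id.pair ((primrec_legOf n).to_comp.pair ((primrec_heightOf n).to_comp.pair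
    (((computable_gadgetIndex hc).comp (primrec_legOf n).to_comp).pair
      ((computable_slotAt hc).comp (primrec_legOf n).to_comp))))

theorem computableGraph_copyGraph (hC : ∀ x, IsCounter n (C x)) (hc : Computable₂ C) :
    ComputableGraph (copyGraph hC) := by
  have hQ : PrimrecPred fun p : (ℕ × ℕ × ℕ × ℕ × ℕ) × (ℕ × ℕ × ℕ × ℕ × ℕ) =>
      p.1.1 ≠ p.2.1 ∧ (DataEdge n p.1 p.2 ∨ DataEdge n p.2 p.1) :=
    .and (.not (Primrec.eq.comp (Primrec.fst.comp Primrec.fst) (Primrec.fst.comp Primrec.snd)))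
      (.or (primrecRel_dataEdge n) ((primrecRel_dataEdge n).comp Primrec.snd Primrec.fst))
  have hd := computable_vertexData (n := n) hc
  refine (hQ.computablePred_comp (f := fun p : ℕ × ℕ => (vertexData n C p.1, vertexData n C p.2))
    ((hd.comp Computable.fst).pair (hd.comp Computable.snd))).of_eq fun p => ?_
  exact (copyGraph_adj hC p.1 p.2).symm

end Computability

/-! ### The distance function of a copy -/

/-- Nonuniform: finitely many values are hard-wired, so nothing need be known about how `T` is
computed. -/
theorem exists_primrec_eqOn {α : Type*} [Primcodable α] (T : α → ℕ) {S : Set α} (hS : S.Finite) :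
    ∃ T' : α → ℕ, Primrec T' ∧ ∀ a ∈ S, T' a = T a := by
  classical
  induction S, hS using Set.Finite.induction_on with
  | empty => exact ⟨fun _ => 0, Primrec.const 0, by simp⟩
  | @insert a S _ _ ih =>
    obtain ⟨T', h, hT'⟩ := ih
    refine ⟨fun b => if b = a then T a else T' b,
      Primrec.ite (Primrec.eq.comp Primrec.id (Primrec.const a)) (Primrec.const _) h, ?_⟩
    rintro b hb
    simp only
    split_ifs with hba
    · rw [hba]
    · exact hT' b (hb.resolve_left hba)

section DistanceFunction

variable {n : ℕ} {C : ℕ → ℕ → ℕ}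

/-- The height, gadget type and slot of the vertex `u`, if `k` is the final value of the counter
of its gadget. -/
def typeData (n : ℕ) (C : ℕ → ℕ → ℕ) (u k : ℕ) : ℕ × ℕ × ℕ :=
  if u = 0 then (legLength n + 1, 0, 0)
  else (heightOf n u, if slotAt n C (legOf n u) = 2 * n + 2 then n + 1 else k,
    slotAt n C (legOf n u))

theorem vertexType_vertexEquiv (hC : ∀ x, IsCounter n (C x)) (u : ℕ) :
    vertexType (vertexEquiv hC u) = typeData n C u (hC (legOf n u).unpair.1).limit := by
  by_cases hu : u = 0
  · subst hu
    rfl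
  · rw [vertexEquiv_of_ne_zero hC hu, typeData, if_neg hu]
    simp [vertexType, toGadgetVertex, gadgetType_gadgetIndex, heightOf]

theorem gadgetOf_vertexEquiv (hC : ∀ x, IsCounter n (C x)) {u : ℕ}
    (hu : vertexEquiv hC u ≠ none) :
    gadgetOf (vertexEquiv hC u) = gadgetIndex n C (legOf n u) := by
  have hu : u ≠ 0 := by
    rintro rfl
    exact hu rfl
  rw [vertexEquiv_of_ne_zero hC hu]
  rfl

theorem slotAt_le (hC : ∀ x, IsCounter n (C x)) (e : ℕ) : slotAt n C e ≤ 2 * n + 2 := by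
  have := hasSlot_slotAt hC e
  simp only [HasSlot] at this
  omega

theorem typeData_mem (hC : ∀ x, IsCounter n (C x)) (u : ℕ) {k : ℕ} (hk : k ≤ n) :
    typeData n C u k ∈ (Finset.range (legLength n + 2) ×ˢ
      (Finset.range (n + 2) ×ˢ Finset.range (2 * n + 3)) : Finset (ℕ × ℕ × ℕ)) := by
  have h₁ := slotAt_le hC (legOf n u)
  have h₂ : heightOf n u < legLength n + 1 := Nat.mod_lt _ (by omega)
  unfold typeData
  split_ifs <;> simp <;> omega

theorem computable_typeData (hc : Computable₂ C) : Computable₂ (typeData n C) := by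
  have h : Primrec fun p : ℕ × ℕ × ℕ => if p.1 = 0 then (legLength n + 1, 0, 0)
      else (heightOf n p.1, if p.2.2 = 2 * n + 2 then n + 1 else p.2.1, p.2.2) := by
    have h₂ := Primrec.snd.comp (Primrec.snd (α := ℕ) (β := ℕ × ℕ))
    exact Primrec.ite (Primrec.eq.comp Primrec.fst (Primrec.const 0)) (Primrec.const _)
      (((primrec_heightOf n).comp Primrec.fst).pair ((Primrec.ite
        (Primrec.eq.comp h₂ (Primrec.const _)) (Primrec.const _)
        (Primrec.fst.comp Primrec.snd)).pair h₂))
  have hs : Computable fun p : ℕ × ℕ => (p.1, p.2, slotAt n C (legOf n p.1)) :=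
    Computable.fst.pair (Computable.snd.pair ((computable_slotAt hc).comp
      ((primrec_legOf n).to_comp.comp Computable.fst)))
  exact (h.to_comp.comp hs).of_eq fun p => rfl

/-- The data of a pair of vertices that determines their distance. -/
def pairData (n : ℕ) (C : ℕ → ℕ → ℕ) (p : ℕ) (k l : ℕ) :
    (ℕ × ℕ × ℕ) × (ℕ × ℕ × ℕ) × Bool :=
  (typeData n C p.unpair.1 k, typeData n C p.unpair.2 l,
    gadgetIndex n C (legOf n p.unpair.1) == gadgetIndex n C (legOf n p.unpair.2))

/-- By symmetry the distance factors through data with finitely many possible values, so a finite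
table computes it. -/
theorem exists_table (hC : ∀ x, IsCounter n (C x)) :
    ∃ T : (ℕ × ℕ × ℕ) × (ℕ × ℕ × ℕ) × Bool → ℕ, Primrec T ∧ ∀ p,
      T (pairData n C p (hC (legOf n p.unpair.1).unpair.1).limit
        (hC (legOf n p.unpair.2).unpair.1).limit) = distanceFunction (copyGraph hC) p := by
  let P : ℕ → (ℕ × ℕ × ℕ) × (ℕ × ℕ × ℕ) × Bool := fun p =>
    pairData n C p (hC (legOf n p.unpair.1).unpair.1).limit
      (hC (legOf n p.unpair.2).unpair.1).limit
  have hf : (distanceFunction (copyGraph hC)).FactorsThrough P := by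
    intro p q hpq
    simp only [P, pairData, Prod.mk.injEq] at hpq
    obtain ⟨h₁, h₂, h₃⟩ := hpq
    simp only [distanceFunction, copyGraph_dist]
    refine dist_eq_of_vertexType ?_ ?_ ?_
    · rw [vertexType_vertexEquiv, vertexType_vertexEquiv, h₁]
    · rw [vertexType_vertexEquiv, vertexType_vertexEquiv, h₂]
    · intro ha hb
      -- The centre is recognised by its height, which exceeds that of every leg vertex.
      have none_iff : ∀ {u v}, vertexType (vertexEquiv hC u) = vertexType (vertexEquiv hC v) →
          vertexEquiv hC u ≠ none → vertexEquiv hC v ≠ none := by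
        intro u v huv hu hv
        rw [hv] at huv
        obtain ⟨⟨w, i⟩, hw⟩ := Option.ne_none_iff_exists'.1 hu
        rw [hw] at huv
        have := congrArg Prod.fst huv
        simp only [vertexType] at this
        omega
      rw [gadgetOf_vertexEquiv hC ha, gadgetOf_vertexEquiv hC hb,
        gadgetOf_vertexEquiv hC (none_iff (by rw [vertexType_vertexEquiv,
          vertexType_vertexEquiv, h₁]) ha),
        gadgetOf_vertexEquiv hC (none_iff (by rw [vertexType_vertexEquiv,
          vertexType_vertexEquiv, h₂]) hb)]
      rw [← beq_iff_eq, h₃, beq_iff_eq]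
  have hfin : (Set.range P).Finite := by
    refine (Finset.finite_toSet ((Finset.range (legLength n + 2) ×ˢ
      (Finset.range (n + 2) ×ˢ Finset.range (2 * n + 3))) ×ˢ
      ((Finset.range (legLength n + 2) ×ˢ (Finset.range (n + 2) ×ˢ Finset.range (2 * n + 3))) ×ˢ
        (Finset.univ : Finset Bool)))).subset ?_
    rintro _ ⟨p, rfl⟩
    exact Finset.mem_product.2 ⟨typeData_mem hC _ (hC _).limit_le_start,
      Finset.mem_product.2 ⟨typeData_mem hC _ (hC _).limit_le_start, Finset.mem_univ _⟩⟩
  obtain ⟨T, hT, h⟩ := exists_primrec_eqOn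
    (Function.extend P (distanceFunction (copyGraph hC)) fun _ => 0) hfin
  exact ⟨T, hT, fun p => (h (P p) ⟨p, rfl⟩).trans (hf.extend_apply _ p)⟩

/-- The map `κ` allows for counters whose limit is known outright: the oracle is still asked, but
its answer may be ignored. -/
theorem distanceFunction_bttReducible (hC : ∀ x, IsCounter n (C x)) (hc : Computable₂ C)
    {c y : ℕ → ℕ} {κ : ℕ → ℕ → ℕ} (hy : Computable y) (hκ : Computable₂ κ)
    (h : ∀ x, (hC x).limit = κ x (c (y x))) :
    BTTReducible 2 (distanceFunction (copyGraph hC)) c := by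
  obtain ⟨T, hT, hd⟩ := exists_table hC
  have hu : Computable fun p : ℕ => p.unpair.1 := Computable.fst.comp Computable.unpair
  have hv : Computable fun p : ℕ => p.unpair.2 := Computable.snd.comp Computable.unpair
  have hl := (primrec_legOf n).to_comp
  have hg : Computable fun u => (legOf n u).unpair.1 := hu.comp hl
  have hgi := computable_gadgetIndex (n := n) hc
  refine ⟨fun p => [y (legOf n p.unpair.1).unpair.1, y (legOf n p.unpair.2).unpair.1],
    fun p l => T (pairData n C p (κ (legOf n p.unpair.1).unpair.1 l.headI)
      (κ (legOf n p.unpair.2).unpair.1 l.tail.headI)), ?_, ?_, fun p => ⟨le_rfl, ?_⟩⟩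
  · exact Computable.list_cons.comp (hy.comp (hg.comp hu))
      (Computable.list_cons.comp (hy.comp (hg.comp hv)) (Computable.const []))
  · have hd : Computable (List.headI : List ℕ → ℕ) := Primrec.list_headI.to_comp
    have htl : Computable (List.tail : List ℕ → List ℕ) := Primrec.list_tail.to_comp
    have p₁ := Computable.fst (α := ℕ) (β := List ℕ)
    have p₂ := Computable.snd (α := ℕ) (β := List ℕ)
    refine hT.to_comp.comp (.pair ?_ (.pair ?_ ?_))
    · exact (computable_typeData hc).comp (hu.comp p₁)
        (hκ.comp (hg.comp (hu.comp p₁)) (hd.comp p₂))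
    · exact (computable_typeData hc).comp (hv.comp p₁)
        (hκ.comp (hg.comp (hv.comp p₁)) (hd.comp (htl.comp p₂)))
    · exact Primrec.beq.to_comp.comp (hgi.comp (hl.comp (hu.comp p₁)))
        (hgi.comp (hl.comp (hv.comp p₁)))
  · rw [← hd p, h, h]
    rfl

theorem dist_eq_limit_add_two (hC : ∀ x, IsCounter n (C x)) (x : ℕ) :
    (copyGraph hC).dist (Nat.pair x 0 * (legLength n + 1) + 1)
      (Nat.pair x 1 * (legLength n + 1) + 1) = (hC x).limit + 2 := by
  have hK : gadgetType n C (fun x => (hC x).limit) (2 * x) = (hC x).limit := by simp [gadgetType]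
  have hk := (hC x).limit_le_start
  have h₀ : HasSlot n (gadgetType n C (fun x => (hC x).limit) (2 * x)) 0 :=
    .inl ⟨hK.trans_le hk, .inl (by omega)⟩
  have h₁ : HasSlot n (gadgetType n C (fun x => (hC x).limit) (2 * x)) 1 :=
    .inl ⟨hK.trans_le hk, .inl (by omega)⟩
  -- The name is that of the foot of leg `Nat.pair x t`; the summand 1 skips the centre, named 0.
  have key : ∀ t (ht : HasSlot n (gadgetType n C (fun x => (hC x).limit) (2 * x)) t),
      t ≤ 1 → vertexEquiv hC (Nat.pair x t * (legLength n + 1) + 1) =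
        some (⟨(2 * x, t), ht⟩, 0) := by
    intro t ht ht'
    have hs : slotAt n C (Nat.pair x t) = t := slotAt_of_lt (by omega)
    rw [vertexEquiv_succ, Nat.mul_div_cancel _ (Nat.succ_pos _), Option.some.injEq,
      Prod.mk.injEq]
    refine ⟨Subtype.ext (Prod.ext ?_ hs), Fin.ext (by simp)⟩
    simp only [toGadgetVertex, gadgetIndex, hs]
    rw [if_neg (by omega), Nat.unpair_pair]
  rw [copyGraph_dist, key 0 h₀ (by omega), key 1 h₁ le_rfl,
    dist_endpoints (hK.trans_le hk), hK]

theorem bttReducible_distanceFunction (hC : ∀ x, IsCounter n (C x)) {c y : ℕ → ℕ}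
    (hy : Computable y) (h : ∀ x, (hC (y x)).limit = c x) :
    BTTReducible 1 c (distanceFunction (copyGraph hC)) := by
  have hp : ∀ t, Computable fun x => Nat.pair (y x) t * (legLength n + 1) + 1 := fun t =>
    Computable.succ.comp (Primrec.nat_mul.to_comp.comp
      (Primrec₂.natPair.to_comp.comp hy (Computable.const t)) (Computable.const _))
  refine ⟨fun x => [Nat.pair (Nat.pair (y x) 0 * (legLength n + 1) + 1)
    (Nat.pair (y x) 1 * (legLength n + 1) + 1)], fun _ l => l.headI - 2, ?_, ?_,
    fun x => ⟨le_rfl, ?_⟩⟩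
  · exact Computable.list_cons.comp (Primrec₂.natPair.to_comp.comp (hp 0) (hp 1))
      (Computable.const [])
  · exact Primrec.nat_sub.to_comp.comp (Primrec.list_headI.to_comp.comp Computable.snd)
      (Computable.const 2)
  · simp [distanceFunction, dist_eq_limit_add_two, h]

end DistanceFunction

/-! ### The main theorem -/

/-- The counter that goes down to `j` at once. -/
theorem isCounter_max {n j : ℕ} (hj : j ≤ n) : IsCounter n fun s => max (n - s) j where
  zero := by simp [hj]
  step s := by omega

theorem limit_isCounter_max {n j : ℕ} (hj : j ≤ n) : (isCounter_max hj).limit = j :=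
  (isCounter_max hj).limit_eq (Filter.eventually_atTop.2 ⟨n, fun s hs => by omega⟩)

theorem mod_succ_le (n x : ℕ) : x % (n + 1) ≤ n := Nat.lt_succ_iff.1 (Nat.mod_lt _ n.succ_pos)

theorem infinite_mod_eq {n j : ℕ} (hj : j ≤ n) : {x | x % (n + 1) = j}.Infinite := by
  refine Set.infinite_of_injective_forall_mem (f := fun x => (n + 1) * x + j) ?_ fun x => ?_
  · intro x y h
    simpa using h
  · simp [Nat.mod_eq_of_lt (Nat.lt_succ_iff.2 hj)]

theorem computable_max_mod (n : ℕ) : Computable₂ fun x s : ℕ => max (n - s) (x % (n + 1)) :=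
  (Primrec.nat_max.comp (Primrec.nat_sub.comp (Primrec.const n) Primrec.snd)
    (Primrec.nat_mod.comp Primrec.fst (Primrec.const (n + 1)))).to_comp

/-- The counters of the approximation `g` interleaved with counters that attain each final value
infinitely often. -/
def interleavedCounter (n : ℕ) (g : ℕ → ℕ → ℕ) (x s : ℕ) : ℕ :=
  if x % 2 = 0 then countdown g (fun _ => n) (x / 2) s else max (n - s) (x / 2 % (n + 1))

theorem Computable₂.interleavedCounter {g : ℕ → ℕ → ℕ} (hg : Computable₂ g) (n : ℕ) :
    Computable₂ (interleavedCounter n g) := by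
  have hx : Computable fun p : ℕ × ℕ => p.1 / 2 :=
    (Primrec.nat_div.comp Primrec.fst (Primrec.const 2)).to_comp
  have hm : Computable fun p : ℕ × ℕ => decide (p.1 % 2 = 0) :=
    (Primrec.eq.comp (Primrec.nat_mod.comp Primrec.fst (Primrec.const 2))
      (Primrec.const 0)).decide.to_comp
  refine (Computable.cond hm ((hg.countdown n).comp hx Computable.snd)
    ((computable_max_mod n).comp hx Computable.snd)).of_eq fun p => ?_
  simp only [_root_.interleavedCounter, Bool.cond_decide]

theorem IsNApproxFromAbove.isCounter_interleavedCounter {n : ℕ} {g : ℕ → ℕ → ℕ} {f : ℕ → ℕ}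
    (h : IsNApproxFromAbove n g f) (x : ℕ) : IsCounter n (interleavedCounter n g x) := by
  unfold interleavedCounter
  by_cases hx : x % 2 = 0
  · simpa only [hx, if_true] using h.isCounter (x / 2)
  · simpa only [hx, if_false] using isCounter_max (mod_succ_le n (x / 2))

theorem IsNApproxFromAbove.limit_interleavedCounter {n : ℕ} {g : ℕ → ℕ → ℕ} {f : ℕ → ℕ}
    (h : IsNApproxFromAbove n g f) (x : ℕ) : (h.isCounter_interleavedCounter x).limit =
      if x % 2 = 0 then (h.isCounter (x / 2)).limit else x / 2 % (n + 1) := by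
  refine (h.isCounter_interleavedCounter x).limit_eq ?_
  unfold interleavedCounter
  by_cases hx : x % 2 = 0
  · simpa only [hx, if_true] using (h.isCounter (x / 2)).eventually_eq_limit
  · simp only [hx, if_false]
    exact Filter.eventually_atTop.2 ⟨n, fun s hs => by omega⟩

/-- The copy of the spider in which every final value is attained infinitely often by counters
that are given explicitly. -/
noncomputable def standardGraph (n : ℕ) : SimpleGraph ℕ :=
  copyGraph fun x => isCounter_max (mod_succ_le n x)

theorem computableGraph_standardGraph (n : ℕ) : ComputableGraph (standardGraph n) :=
  computableGraph_copyGraph _ (computable_max_mod n)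

theorem standardGraph_connected (n : ℕ) : (standardGraph n).Connected := copyGraph_connected _

theorem standardGraph_dist_le (n u v : ℕ) : (standardGraph n).dist u v ≤ n + 2 := by
  rw [standardGraph, copyGraph_dist]
  exact spider_dist_le n _ _ _

theorem intrinsicallyNApproximable_standardGraph (n : ℕ) :
    IntrinsicallyNApproximableFromAbove n (standardGraph n) := by
  rintro H ⟨hH, ⟨φ⟩⟩
  have hc := φ.connected_iff.1 (standardGraph_connected n)
  refine nApproximable_distanceFunction hH hc fun u v => ?_
  rw [← hc.dist_iso φ.symm]
  exact standardGraph_dist_le n _ _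

theorem exists_copy_of_approximation {n : ℕ} {f : ℕ → ℕ} {g : ℕ → ℕ → ℕ}
    (h : IsNApproxFromAbove n g f) :
    ∃ H, IsComputableCopy (standardGraph n) H ∧
      ∃ c : ℕ → ℕ, IsPointwiseLimit (countdown g fun _ => n) c ∧
        BTTReducible 2 (distanceFunction H) c ∧ BTTReducible 1 c (distanceFunction H) := by
  have hg := h.computable.interleavedCounter n
  have hlim := h.limit_interleavedCounter
  have hC := h.isCounter_interleavedCounter
  have h2 : Primrec fun x : ℕ => x / 2 := Primrec.nat_div.comp Primrec.id (Primrec.const 2)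
  refine ⟨copyGraph hC, ⟨computableGraph_copyGraph _ hg, ?_⟩,
    fun x => (h.isCounter x).limit, fun x => (h.isCounter x).eventually_eq_limit, ?_, ?_⟩
  · refine nonempty_copyGraph_iso _ _ (fun j hj => ?_) fun j hj => ?_
    · exact (infinite_mod_eq hj).mono fun x hx => (limit_isCounter_max (mod_succ_le n x)).trans hx
    -- The odd-indexed counters alone attain each final value infinitely often, whatever `g` does.
    · refine ((infinite_mod_eq hj).image (f := fun x => 2 * x + 1)
        fun x _ y _ hxy => by simpa using hxy).mono ?_
      rintro _ ⟨x, hx, rfl⟩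
      simpa [hlim, show (2 * x + 1) / 2 = x by omega] using hx
  · have hκ : Primrec₂ fun x a : ℕ => if x % 2 = 0 then a else x / 2 % (n + 1) :=
      Primrec.ite (Primrec.eq.comp (Primrec.nat_mod.comp Primrec.fst (Primrec.const 2))
        (Primrec.const 0)) Primrec.snd
        (Primrec.nat_mod.comp (h2.comp Primrec.fst) (Primrec.const (n + 1)))
    exact distanceFunction_bttReducible hC hg h2.to_comp hκ.to_comp hlim
  · refine bttReducible_distanceFunction hC (y := fun x => 2 * x)
      (Primrec.nat_mul.comp (Primrec.const 2) Primrec.id).to_comp fun x => ?_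
    simp [hlim]

theorem distanceSpectrum_standardGraph (n : ℕ) : distanceSpectrum (standardGraph n) =
    {D | (∃ α, D = boundedTuringDegree α) ∧ ∃ f ∈ D, NApproximableFromAbove n f} := by
  ext D
  constructor
  · rintro ⟨H, hH, rfl⟩
    exact ⟨⟨_, rfl⟩, _, self_mem_boundedTuringDegree _,
      intrinsicallyNApproximable_standardGraph n H hH⟩
  · rintro ⟨⟨α, rfl⟩, f, hf, g, hg⟩
    obtain ⟨H, hH, c, hc, h₁, h₂⟩ := exists_copy_of_approximation hg
    refine ⟨H, hH, ?_⟩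
    have hd : distanceFunction H ∈ boundedTuringDegree c :=
      ⟨h₁.boundedTuring, (h₂.mono one_le_two).boundedTuring⟩
    rw [boundedTuringDegree_eq hd, ← boundedTuringDegree_eq (hg.mem_boundedTuringDegree hc),
      boundedTuringDegree_eq hf]

theorem theorem5p4 (n : ℕ) :
    ∃ G : SimpleGraph ℕ, ComputableGraph G ∧ G.Connected ∧
      IntrinsicallyNApproximableFromAbove n G ∧
      (∀ f g, IsNApproxFromAbove n g f →
        ∃ H, IsComputableCopy G H ∧
          ∃ c : ℕ → ℕ, IsPointwiseLimit (countdown g fun _ => n) c ∧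
            BTTReducible 2 (distanceFunction H) c ∧
            BTTReducible 1 c (distanceFunction H)) ∧
      distanceSpectrum G =
        {D | (∃ α, D = boundedTuringDegree α) ∧ ∃ f ∈ D, NApproximableFromAbove n f} :=
  ⟨standardGraph n, computableGraph_standardGraph n, standardGraph_connected n,
    intrinsicallyNApproximable_standardGraph n, fun _ _ h => exists_copy_of_approximation h,
    distanceSpectrum_standardGraph n⟩
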